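/- Let $V$ be a real vector space of finite dimension $n$, and let $\mathcal K(V)$ be the set of nonempty convex compact subsets of $V$ with the Hausdorff metric. A valuation is a function $\phi:\mathcal K(V)\to\mathbb C$ with $\phi(K\cup L)=\phi(K)+\phi(L)-\phi(K\cap L)$ whenever $K,L,K\cup L\in\mathcal K(V)$. Let $QV(V)$ be the space of continuous valuations $\phi$ such that, for every $K\in\mathcal K(V)$, the function $(t,x)\mapsto\phi(tK+x)$ is of class $C^n$ on $[0,1]\times V$ and the map $K\mapsto[(t,x)\mapsto\phi(tK+x)]$ is continuous from $\mathcal K(V)$ to $C^n([0,1]\times V)$ (with uniform convergence of all derivatives of order at most $n$ on compact sets). Equip $QV(V)$ with the topology defined by the seminorms $$\|\phi\|_G=\sup\{\|\phi(tK+x)\|_{C^n([0,1]\times G)} : K\in\mathcal K(V),\ K\subset G\},\qquad G\subset V \text{ compact}.$$ The group $\mathrm{Aff}(V)$ of invertible affine transformations of $V$ acts on $QV(V)$ by $(g\phi)(K)=\phi(g^{-1}K)$. Let $SV(V)\subset QV(V)$ be the subspace of smooth valuations, that is, of those $\phi$ for which the map $g\mapsto g\phi$ from the Lie group $\mathrm{Aff}(V)$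 to $QV(V)$ is infinitely differentiable. Put $$W_n=\Big\{\phi\in SV(V) : \frac{d^k}{dt^k}\phi(tK+x)\Big|_{t=0}=0\ \text{ for all } 0\le k<n,\ K\in\mathcal K(V),\ x\in V\Big\},$$ where the derivatives at $t=0$ are one-sided. Then $W_n$ coincides with the space of smooth (complex-valued) densities on $V$: for any Lebesgue measure $dx$ on $V$, the map which sends $f\in C^\infty(V,\mathbb C)$ to the function $K\mapsto\int_K f(x)\,dx$ on $\mathcal K(V)$ is a bijection from $C^\infty(V,\mathbb C)$ onto $W_n$. -/

import Mathlib

open Set Filter Topology MeasureTheory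
open scoped ContDiff

noncomputable section

namespace SmoothValuation

/-! ### Convex bodies and valuations

`ConvexBody V` is Mathlib's type of nonempty convex compact subsets of `V` with the Hausdorff
metric. -/

section Basic

variable {V : Type*} [NormedAddCommGroup V] [NormedSpace ℝ V]

/-- The one-point convex body `{x}`. -/
def point (x : V) : ConvexBody V :=
  ⟨{x}, convex_singleton x, isCompact_singleton, singleton_nonempty x⟩

/-- Finitely additive functions: `φ(K ∪ L) = φ(K) + φ(L) - φ(K ∩ L)` whenever `K ∪ L` is convex.
(If `K`, `L` are nonempty convex compact sets with convex union, then `K ∩ L` is automatically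
nonempty, so that it is a convex body as well.) -/
def IsValuation (φ : ConvexBody V → ℂ) : Prop :=
  ∀ K L M N : ConvexBody V, (M : Set V) = (K : Set V) ∪ L → (N : Set V) = (K : Set V) ∩ L →
    φ M = φ K + φ L - φ N

/-- The function `(t, x) ↦ φ(tK + x)`, to be considered on `[0,1] × V`. -/
def scaleTranslate (φ : ConvexBody V → ℂ) (K : ConvexBody V) : ℝ × V → ℂ :=
  fun p => φ (p.1 • K + point p.2)

variable (V) in
/-- The manifold with boundary `[0,1] × V`, as a subset of `ℝ × V`. -/
def strip : Set (ℝ × V) := Icc (0 : ℝ) 1 ×ˢ univ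

/-- The `k`-th derivative of `(t, x) ↦ φ(tK + x)` on `[0,1] × V` (one-sided at the boundary). -/
def stDeriv (k : ℕ) (φ : ConvexBody V → ℂ) (K : ConvexBody V) (p : ℝ × V) :
    (ℝ × V) [×k]→L[ℝ] ℂ :=
  iteratedFDerivWithin ℝ k (scaleTranslate φ K) (strip V) p

/-- Quasi-smooth valuations: continuous valuations `φ` such that `K ↦ [(t, x) ↦ φ(tK + x)]` is a
continuous map from convex bodies to `C^n([0,1] × V)`, `n = dim V`. The topology of
`C^n([0,1] × V)` is that of uniform convergence on compact sets of all derivatives of order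
at most `n`. -/
structure IsQuasiSmooth (φ : ConvexBody V → ℂ) : Prop where
  isValuation : IsValuation φ
  continuous : Continuous φ
  contDiffOn : ∀ K, ContDiffOn ℝ (Module.finrank ℝ V) (scaleTranslate φ K) (strip V)
  continuous_stDeriv : ∀ K : ConvexBody V, ∀ G : Set V, IsCompact G →
    ∀ k ≤ Module.finrank ℝ V,
      TendstoUniformlyOn (fun L p => stDeriv k φ L p) (stDeriv k φ K) (𝓝 K) (Icc (0 : ℝ) 1 ×ˢ G)

lemma uniqueDiffOn_strip : UniqueDiffOn ℝ (strip V) :=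
  uniqueDiffOn_Icc_zero_one.prod uniqueDiffOn_univ

lemma stDeriv_add {φ ψ : ConvexBody V → ℂ} (hφ : IsQuasiSmooth φ) (hψ : IsQuasiSmooth ψ)
    {k : ℕ} (hk : k ≤ Module.finrank ℝ V) (K : ConvexBody V) {p : ℝ × V} (hp : p ∈ strip V) :
    stDeriv k (φ + ψ) K p = stDeriv k φ K p + stDeriv k ψ K p :=
  iteratedFDerivWithin_add_apply (((hφ.contDiffOn K) p hp).of_le (by exact_mod_cast hk))
    (((hψ.contDiffOn K) p hp).of_le (by exact_mod_cast hk)) uniqueDiffOn_strip hp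

lemma stDeriv_smul {φ : ConvexBody V → ℂ} (hφ : IsQuasiSmooth φ) (c : ℂ)
    {k : ℕ} (hk : k ≤ Module.finrank ℝ V) (K : ConvexBody V) {p : ℝ × V} (hp : p ∈ strip V) :
    stDeriv k (c • φ) K p = c • stDeriv k φ K p :=
  iteratedFDerivWithin_const_smul_apply (((hφ.contDiffOn K) p hp).of_le (by exact_mod_cast hk))
    uniqueDiffOn_strip hp

lemma prod_subset_strip {V : Type*} (G : Set V) : Icc (0 : ℝ) 1 ×ˢ G ⊆ strip V :=
  prod_mono le_rfl (subset_univ _)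

variable (V) in
/-- Quasi-smooth valuations form a complex vector space. -/
def quasiSmoothSubmodule : Submodule ℂ (ConvexBody V → ℂ) where
  carrier := {φ | IsQuasiSmooth φ}
  add_mem' := by
    intro φ ψ hφ hψ
    refine ⟨?_, hφ.continuous.add hψ.continuous,
      fun K => (hφ.contDiffOn K).add (hψ.contDiffOn K), ?_⟩
    · intro K L M N h1 h2
      simp only [Pi.add_apply, hφ.isValuation K L M N h1 h2, hψ.isValuation K L M N h1 h2]
      ring
    · intro K G hG k hk
      have h := (hφ.continuous_stDeriv K G hG k hk).add (hψ.continuous_stDeriv K G hG k hk)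
      refine (h.congr (.of_forall fun L p hp => ?_)).congr_right fun p hp => ?_
      · exact (stDeriv_add hφ hψ hk L (prod_subset_strip G hp)).symm
      · exact (stDeriv_add hφ hψ hk K (prod_subset_strip G hp)).symm
  zero_mem' := by
    have h0 : ∀ K : ConvexBody V, scaleTranslate (0 : ConvexBody V → ℂ) K = 0 := fun K => rfl
    refine ⟨fun K L M N _ _ => by simp, continuous_const, fun K => ?_, fun K G hG k hk => ?_⟩
    · rw [h0]; exact contDiffOn_const
    · simp only [stDeriv, h0]
      exact fun u hu => .of_forall fun L p _ => refl_mem_uniformity hu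
  smul_mem' := by
    intro c φ hφ
    refine ⟨?_, hφ.continuous.const_smul c, fun K => (hφ.contDiffOn K).const_smul c, ?_⟩
    · intro K L M N h1 h2
      simp only [Pi.smul_apply, smul_eq_mul, hφ.isValuation K L M N h1 h2]
      ring
    · intro K G hG k hk
      have h := (uniformContinuous_const_smul c).comp_tendstoUniformlyOn
        (hφ.continuous_stDeriv K G hG k hk)
      refine (h.congr (.of_forall fun L p hp => ?_)).congr_right fun p hp => ?_
      · exact (stDeriv_smul hφ c hk L (prod_subset_strip G hp)).symm
      · exact (stDeriv_smul hφ c hk K (prod_subset_strip G hp)).symm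

variable (V) in
/-- The space `QV(V)` of quasi-smooth valuations. -/
def QV : Type _ := ↥(quasiSmoothSubmodule V)

instance : AddCommGroup (QV V) := inferInstanceAs (AddCommGroup ↥(quasiSmoothSubmodule V))
instance : Module ℂ (QV V) := inferInstanceAs (Module ℂ ↥(quasiSmoothSubmodule V))
instance : Module ℝ (QV V) := inferInstanceAs (Module ℝ ↥(quasiSmoothSubmodule V))
instance : IsScalarTower ℝ ℂ (QV V) :=
  inferInstanceAs (IsScalarTower ℝ ℂ ↥(quasiSmoothSubmodule V))

variable (V) in
/-- The inclusion of `QV(V)` into all functions of convex bodies. -/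
def QV.incl : QV V →ₗ[ℂ] (ConvexBody V → ℂ) := (quasiSmoothSubmodule V).subtype

lemma QV.isQuasiSmooth (φ : QV V) : IsQuasiSmooth (QV.incl V φ) := φ.2

/-! ### The topology of `QV(V)` -/

/-- The convex bodies contained in a compact set form a compact family. -/
lemma isCompact_subsets {G : Set V} (hG : IsCompact G) :
    IsCompact {K : ConvexBody V | (K : Set V) ⊆ G} := by
  let j : ConvexBody V → TopologicalSpace.NonemptyCompacts V :=
    fun K => ⟨⟨K, K.isCompact⟩, K.nonempty⟩
  have hj : Isometry j := fun K L => by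
    rw [← ConvexBody.hausdorffEDist_coe]; rfl
  have hS := TopologicalSpace.NonemptyCompacts.isCompact_subsets_of_isCompact hG
  have hcl : IsClosed (range j) := by
    refine isClosed_of_closure_subset fun L hL => ?_
    have hconv : Convex ℝ (L : Set V) := by
      intro x hx y hy a b ha hb hab
      have hLc : IsClosed (L : Set V) := L.isCompact.isClosed
      rw [← hLc.closure_eq, Metric.mem_closure_iff]
      intro ε hε
      obtain ⟨_, ⟨K, rfl⟩, hK⟩ := Metric.mem_closure_iff.1 hL (ε / 2) (by positivity)
      have hd : Metric.hausdorffDist (L : Set V) (K : Set V) < ε / 2 := hK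
      have hne : Metric.hausdorffEDist (L : Set V) (K : Set V) ≠ ⊤ :=
        Metric.hausdorffEDist_ne_top_of_nonempty_of_bounded L.nonempty K.nonempty
          L.isCompact.isBounded K.isBounded
      obtain ⟨x', hx', hxx⟩ := Metric.exists_dist_lt_of_hausdorffDist_lt hx hd hne
      obtain ⟨y', hy', hyy⟩ := Metric.exists_dist_lt_of_hausdorffDist_lt hy hd hne
      obtain ⟨w, hw, hww⟩ := Metric.exists_dist_lt_of_hausdorffDist_lt'
        (K.convex hx' hy' ha hb hab) hd hne
      refine ⟨w, hw, ?_⟩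
      have h1 : dist (a • x + b • y) (a • x' + b • y') ≤ ε / 2 := by
        calc _ ≤ dist (a • x) (a • x') + dist (b • y) (b • y') := dist_add_add_le _ _ _ _
          _ = a * dist x x' + b * dist y y' := by
            rw [dist_smul₀, dist_smul₀, Real.norm_of_nonneg ha, Real.norm_of_nonneg hb]
          _ ≤ a * (ε / 2) + b * (ε / 2) := by gcongr
          _ = ε / 2 := by rw [← add_mul, hab, one_mul]
      have := dist_triangle (a • x + b • y) (a • x' + b • y') w
      rw [dist_comm w] at hww
      linarith
    exact ⟨⟨L, hconv, L.isCompact, L.nonempty⟩, by ext; rfl⟩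
  have hce : IsClosedEmbedding j := ⟨hj.isEmbedding, hcl⟩
  exact hce.isCompact_preimage hS

/-- Index set of the supremum in the seminorm `‖·‖_G`: a body `K ⊆ G`, an order `k ≤ n`
of differentiation and a point `(t, x) ∈ [0,1] × G`. -/
abbrev SeminormIndex (G : Set V) : Type _ :=
  {q : ConvexBody V × ℕ × (ℝ × V) // (q.1 : Set V) ⊆ G ∧ q.2.1 ≤ Module.finrank ℝ V ∧
    q.2.2 ∈ Icc (0 : ℝ) 1 ×ˢ G}

/-- The norm of the derivative of `(t, x) ↦ φ(tK + x)` specified by an index. -/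
def seminormTerm {G : Set V} (φ : QV V) (q : SeminormIndex G) : ℝ :=
  ‖stDeriv q.1.2.1 (QV.incl V φ) q.1.1 q.1.2.2‖

lemma bddAbove_seminormTerm {G : Set V} (hG : IsCompact G) (φ : QV V) :
    BddAbove (range (seminormTerm (G := G) φ)) := by
  obtain ⟨φ, hφ : IsQuasiSmooth φ⟩ := φ
  have key : ∀ k ≤ Module.finrank ℝ V, ∃ C : ℝ, ∀ K : ConvexBody V, (K : Set V) ⊆ G →
      ∀ p ∈ Icc (0 : ℝ) 1 ×ˢ G, ‖stDeriv k φ K p‖ ≤ C := by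
    intro k hk
    refine (isCompact_subsets hG).induction_on
      (p := fun S => ∃ C : ℝ, ∀ K ∈ S, ∀ p ∈ Icc (0 : ℝ) 1 ×ˢ G, ‖stDeriv k φ K p‖ ≤ C)
      ⟨0, by simp⟩ ?_ ?_ ?_
    · rintro S T hST ⟨C, hC⟩
      exact ⟨C, fun K hK => hC K (hST hK)⟩
    · rintro S T ⟨C, hC⟩ ⟨D, hD⟩
      refine ⟨max C D, fun K hK p hp => ?_⟩
      rcases hK with hK | hK
      · exact (hC K hK p hp).trans (le_max_left _ _)
      · exact (hD K hK p hp).trans (le_max_right _ _)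
    · intro K _
      have hcont : ContinuousOn (stDeriv k φ K) (Icc (0 : ℝ) 1 ×ˢ G) :=
        ((hφ.contDiffOn K).continuousOn_iteratedFDerivWithin (by exact_mod_cast hk)
          uniqueDiffOn_strip).mono (prod_subset_strip G)
      obtain ⟨C, hC⟩ := (isCompact_Icc.prod hG).exists_bound_of_continuousOn hcont
      have h := Metric.tendstoUniformlyOn_iff.1 (hφ.continuous_stDeriv K G hG k hk) 1 one_pos
      refine ⟨_, mem_nhdsWithin_of_mem_nhds h, C + 1, fun L hL p hp => ?_⟩
      have h1 := hL p hp
      rw [dist_eq_norm, norm_sub_rev] at h1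
      have h2 := hC p hp
      have h3 := norm_le_norm_add_norm_sub' (stDeriv k φ L p) (stDeriv k φ K p)
      linarith
  choose! C hC using key
  refine ⟨∑ k ∈ Finset.range (Module.finrank ℝ V + 1), |C k|, ?_⟩
  rintro _ ⟨⟨⟨K, k, p⟩, hK, hk, hp⟩, rfl⟩
  refine (hC k hk K hK p hp).trans ((le_abs_self _).trans ?_)
  exact Finset.single_le_sum (f := fun k => |C k|) (fun _ _ => abs_nonneg _)
    (Finset.mem_range.2 (Nat.lt_succ_of_le hk))

/-- The seminorm `‖φ‖_G = sup {‖φ(tK + x)‖_{C^n([0,1] × G)} | K ⊆ G}` on `QV(V)`, for a compact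
set `G`. -/
def quasiSmoothSeminorm (G : TopologicalSpace.Compacts V) : Seminorm ℂ (QV V) :=
  Seminorm.of (fun φ => ⨆ q : SeminormIndex (G : Set V), seminormTerm φ q)
    (by
      intro φ ψ
      refine Real.iSup_le (fun q => ?_) (add_nonneg (Real.iSup_nonneg fun _ => norm_nonneg _)
        (Real.iSup_nonneg fun _ => norm_nonneg _))
      have h : seminormTerm (φ + ψ) q ≤ seminormTerm φ q + seminormTerm ψ q := by
        unfold seminormTerm
        rw [map_add, stDeriv_add φ.isQuasiSmooth ψ.isQuasiSmooth q.2.2.1 _ (prod_subset_strip _ q.2.2.2)]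
        exact norm_add_le _ _
      exact h.trans (add_le_add (le_ciSup (bddAbove_seminormTerm G.isCompact φ) q)
        (le_ciSup (bddAbove_seminormTerm G.isCompact ψ) q)))
    (by
      intro c φ
      rw [Real.mul_iSup_of_nonneg (norm_nonneg c)]
      congr 1
      ext q
      unfold seminormTerm
      rw [map_smul, stDeriv_smul φ.isQuasiSmooth c q.2.2.1 _ (prod_subset_strip _ q.2.2.2), norm_smul])

/-- The topology of `QV(V)` is defined by the seminorms `‖·‖_G`, `G ⊆ V` compact. -/
instance : TopologicalSpace (QV V) :=
  (SeminormFamily.moduleFilterBasis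
    (quasiSmoothSeminorm : SeminormFamily ℂ (QV V) (TopologicalSpace.Compacts V))).topology

lemma withSeminorms_QV : WithSeminorms
    (quasiSmoothSeminorm : SeminormFamily ℂ (QV V) (TopologicalSpace.Compacts V)) := ⟨rfl⟩

instance : IsTopologicalAddGroup (QV V) := withSeminorms_QV.topologicalAddGroup
instance : ContinuousSMul ℂ (QV V) := withSeminorms_QV.continuousSMul

end Basic

/-! ### Infinitely differentiable maps into a topological vector space -/

section Smooth

variable {E F : Type*} [NormedAddCommGroup E] [NormedSpace ℝ E]
  [AddCommGroup F] [Module ℝ F] [TopologicalSpace F]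

/-- `f` is of class `C^k` on the open subset `U` of the finite dimensional space `E`, as a map with
values in the topological vector space `F`: it is continuous, and its directional derivatives in
all directions (limits of difference quotients in the topology of `F`) exist on `U` and are of
class `C^{k-1}`. -/
def IsCkOn (U : Set E) : ℕ → (E → F) → Prop
  | 0, f => ContinuousOn f U
  | k + 1, f => ContinuousOn f U ∧ ∀ v : E, ∃ f' : E → F,
      (∀ x ∈ U, Tendsto (fun t : ℝ => t⁻¹ • (f (x + t • v) - f x)) (𝓝[≠] 0) (𝓝 (f' x))) ∧
      IsCkOn U k f'

/-- `f` is infinitely differentiable on the open set `U`. -/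
def IsSmoothOn (U : Set E) (f : E → F) : Prop := ∀ k, IsCkOn U k f

lemma IsCkOn.add [ContinuousAdd F] {U : Set E} {k : ℕ} {f g : E → F}
    (hf : IsCkOn U k f) (hg : IsCkOn U k g) : IsCkOn U k (f + g) := by
  induction k generalizing f g with
  | zero => exact ContinuousOn.add hf hg
  | succ k ih =>
    refine ⟨hf.1.add hg.1, fun v => ?_⟩
    obtain ⟨f', hf', hf''⟩ := hf.2 v
    obtain ⟨g', hg', hg''⟩ := hg.2 v
    refine ⟨f' + g', fun x hx => ((hf' x hx).add (hg' x hx)).congr fun t => ?_, ih hf'' hg''⟩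
    simp only [Pi.add_apply, ← smul_add]
    congr 1
    abel

lemma IsCkOn.const_smul [Module ℂ F] [IsScalarTower ℝ ℂ F] [ContinuousConstSMul ℂ F] {U : Set E}
    {k : ℕ} {f : E → F} (c : ℂ) (hf : IsCkOn U k f) : IsCkOn U k (c • f) := by
  induction k generalizing f with
  | zero => exact ContinuousOn.const_smul hf c
  | succ k ih =>
    refine ⟨hf.1.const_smul c, fun v => ?_⟩
    obtain ⟨f', hf', hf''⟩ := hf.2 v
    refine ⟨c • f', fun x hx => ((hf' x hx).const_smul c).congr fun t => ?_, ih hf''⟩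
    simp only [Pi.smul_apply, ← smul_sub]
    rw [← smul_one_smul ℂ t⁻¹ (f (x + t • v) - f x),
      ← smul_one_smul ℂ t⁻¹ (c • (f (x + t • v) - f x)), smul_smul, smul_smul, mul_comm]

lemma IsCkOn.zero {U : Set E} (k : ℕ) : IsCkOn U k (0 : E → F) := by
  induction k with
  | zero => exact continuousOn_const
  | succ k ih =>
    refine ⟨continuousOn_const, fun v => ⟨0, fun x _ => ?_, ih⟩⟩
    simpa using tendsto_const_nhds

end Smooth

/-! ### The affine group, smooth valuations and the filtration -/

section Affine

variable {V : Type*} [NormedAddCommGroup V] [NormedSpace ℝ V] [FiniteDimensional ℝ V]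

/-- The image of a convex body under an affine transformation. -/
def affImage (g : V ≃ᵃ[ℝ] V) (K : ConvexBody V) : ConvexBody V :=
  ⟨g '' K, K.convex.affine_image g.toAffineMap,
    K.isCompact.image g.toAffineMap.continuous_of_finiteDimensional, K.nonempty.image g⟩

/-- The linear part of an affine transformation, as an affine transformation fixing `0`. -/
def linPart (g : V ≃ᵃ[ℝ] V) : V ≃ᵃ[ℝ] V := g.linear.toAffineEquiv

lemma continuous_affImage (g : V ≃ᵃ[ℝ] V) : Continuous (affImage g) := by
  let j : ConvexBody V → TopologicalSpace.NonemptyCompacts V :=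
    fun K => ⟨⟨K, K.isCompact⟩, K.nonempty⟩
  have hj : Isometry j := fun K L => by
    rw [← ConvexBody.hausdorffEDist_coe]; rfl
  have hg : Continuous g := g.toAffineMap.continuous_of_finiteDimensional
  rw [hj.isEmbedding.continuous_iff]
  exact hg.nonemptyCompacts_map.comp hj.continuous

lemma apply_eq_linear_add {V : Type*} [AddCommGroup V] [Module ℝ V] (g : V ≃ᵃ[ℝ] V) (x : V) : g x = g.linear x + g 0 := by
  simpa using g.map_vadd 0 x

open scoped Pointwise in
lemma affImage_smul_add_point (g : V ≃ᵃ[ℝ] V) (t : ℝ) (K : ConvexBody V) (x : V) :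
    affImage g (t • K + point x) = t • affImage (linPart g) K + point (g x) := by
  apply ConvexBody.ext
  change g '' (t • (K : Set V) + {x}) = t • (g.linear '' (K : Set V)) + {g x}
  rw [add_singleton, add_singleton]
  ext y
  simp only [← image_smul, image_image]
  have : ∀ z, g (t • z + x) = t • g.linear z + g x := fun z => by
    rw [apply_eq_linear_add g, apply_eq_linear_add g x]; simp [add_assoc]
  simp [this]

/-- The linear automorphism `id × A` of `ℝ × V`, where `A` is the linear part of `g`. -/
def stripLin (g : V ≃ᵃ[ℝ] V) : (ℝ × V) ≃L[ℝ] (ℝ × V) :=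
  (ContinuousLinearEquiv.refl ℝ ℝ).prodCongr g.linear.toContinuousLinearEquiv

lemma scaleTranslate_affImage (φ : ConvexBody V → ℂ) (g : V ≃ᵃ[ℝ] V) (K : ConvexBody V) :
    scaleTranslate (fun L => φ (affImage g L)) K =
      (fun p => scaleTranslate φ (affImage (linPart g) K) (p + (0, g 0))) ∘ stripLin g := by
  funext p
  simp only [scaleTranslate, affImage_smul_add_point, Function.comp]
  rw [apply_eq_linear_add g p.2]
  simp [stripLin]

open scoped Pointwise in
lemma stDeriv_affImage (φ : ConvexBody V → ℂ) (g : V ≃ᵃ[ℝ] V) (K : ConvexBody V) (k : ℕ)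
    {p : ℝ × V} (hp : p ∈ strip V) :
    stDeriv k (fun L => φ (affImage g L)) K p =
      (stDeriv k φ (affImage (linPart g) K) (p.1, g p.2)).compContinuousLinearMap
        fun _ => (stripLin g : (ℝ × V) →L[ℝ] (ℝ × V)) := by
  have hs : stripLin g ⁻¹' strip V = strip V := by
    ext q; simp [strip, stripLin]
  have hs' : ((0 : ℝ), g 0) +ᵥ strip V = strip V := by
    ext q; simp [strip, mem_vadd_set_iff_neg_vadd_mem]
  have hp' : stripLin g p ∈ strip V := by rwa [← mem_preimage, hs]
  unfold stDeriv
  rw [scaleTranslate_affImage]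
  conv_lhs => rw [← hs]
  rw [(stripLin g).iteratedFDerivWithin_comp_right _ uniqueDiffOn_strip hp' k,
    iteratedFDerivWithin_comp_add_right, hs']
  have : stripLin g p + (0, g 0) = (p.1, g p.2) := by
    rw [apply_eq_linear_add g p.2]; simp [stripLin]
  rw [this]

lemma IsQuasiSmooth.affImage {φ : ConvexBody V → ℂ} (hφ : IsQuasiSmooth φ) (g : V ≃ᵃ[ℝ] V) :
    IsQuasiSmooth (fun K => φ (affImage g K)) := by
  refine ⟨?_, hφ.continuous.comp (continuous_affImage g), fun K => ?_, ?_⟩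
  · intro K L M N h1 h2
    apply hφ.isValuation
    · change g '' M = g '' K ∪ g '' L
      rw [h1, image_union]
    · change g '' N = g '' K ∩ g '' L
      rw [h2, image_inter g.injective]
  · rw [scaleTranslate_affImage]
    refine (((hφ.contDiffOn (SmoothValuation.affImage (linPart g) K)).comp
      (s := strip V) (f := fun p => p + ((0 : ℝ), g 0)) ?_ ?_)).comp (s := strip V)
      (stripLin g).contDiff.contDiffOn ?_
    · exact (contDiff_id.add contDiff_const).contDiffOn
    · intro p hp; simpa [strip] using hp
    · intro p hp; simpa [strip, stripLin] using hp
  · intro K G hG k hk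
    have hgc : Continuous g := g.toAffineMap.continuous_of_finiteDimensional
    have h := hφ.continuous_stDeriv (SmoothValuation.affImage (linPart g) K) (g '' G)
      (hG.image hgc) k hk
    have h1 := (((h.comp fun p : ℝ × V => (p.1, g p.2)).mono
      (s' := Icc (0 : ℝ) 1 ×ˢ G) ?_).congr_right (fun _ _ => rfl))
    · have h2 : TendstoUniformlyOn
          (fun L p => stDeriv k φ (SmoothValuation.affImage (linPart g) L) (p.1, g p.2))
          (fun p : ℝ × V => stDeriv k φ (SmoothValuation.affImage (linPart g) K) (p.1, g p.2))
          (𝓝 K) (Icc (0 : ℝ) 1 ×ˢ G) := fun u hu =>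
        ((continuous_affImage (linPart g)).tendsto K).eventually (h1 u hu)
      have h3 := (ContinuousMultilinearMap.compContinuousLinearMapL
        (fun _ : Fin k => (stripLin g : (ℝ × V) →L[ℝ] (ℝ × V))) :
          ((ℝ × V) [×k]→L[ℝ] ℂ) →L[ℝ] ((ℝ × V) [×k]→L[ℝ] ℂ)).uniformContinuous
          |>.comp_tendstoUniformlyOn h2
      refine (h3.congr (.of_forall fun L p hp => ?_)).congr_right fun p hp => ?_
      · exact (stDeriv_affImage φ g L k (prod_subset_strip G hp)).symm
      · exact (stDeriv_affImage φ g K k (prod_subset_strip G hp)).symm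
    · rintro ⟨t, x⟩ ⟨ht, hx⟩
      exact ⟨ht, mem_image_of_mem g hx⟩

/-- The natural action of the affine group `Aff(V)` on `QV(V)`: `(gφ)(K) = φ(g⁻¹K)`. -/
def affAct (g : V ≃ᵃ[ℝ] V) : QV V →ₗ[ℂ] QV V where
  toFun φ := ⟨fun K => QV.incl V φ (affImage g⁻¹ K), IsQuasiSmooth.affImage φ.2 g⁻¹⟩
  map_add' _ _ := rfl
  map_smul' _ _ := rfl

/-- The global chart of the Lie group `Aff(V)`: the map `x ↦ Ax + b` has coordinates `(A, b)`. Its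
image is the open set of pairs `(A, b)` with `A` invertible. -/
def affCoord (g : V ≃ᵃ[ℝ] V) : (V →L[ℝ] V) × V :=
  (LinearMap.toContinuousLinearMap (g.linear : V →ₗ[ℝ] V), g 0)

/-- `φ ∈ QV(V)` is an `Aff(V)`-smooth vector: the orbit map `g ↦ gφ`, `Aff(V) → QV(V)`, is
infinitely differentiable. (`f` is the orbit map in the global chart; its values outside the
image of the chart are irrelevant.) -/
def IsAffSmooth (φ : QV V) : Prop :=
  ∃ f : (V →L[ℝ] V) × V → QV V,
    IsSmoothOn {p | IsUnit p.1} f ∧ ∀ g : V ≃ᵃ[ℝ] V, f (affCoord g) = affAct g φ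

variable (V) in
/-- The space `SV(V)` of smooth valuations: the `Aff(V)`-smooth vectors of `QV(V)`. -/
def SV : Submodule ℂ (QV V) where
  carrier := {φ | IsAffSmooth φ}
  add_mem' := by
    rintro φ ψ ⟨f, hf, hf'⟩ ⟨h, hh, hh'⟩
    exact ⟨f + h, fun k => (hf k).add (hh k), fun g => by simp [hf', hh']⟩
  zero_mem' := ⟨0, fun k => IsCkOn.zero k, fun g => by simp⟩
  smul_mem' := by
    rintro c φ ⟨f, hf, hf'⟩
    exact ⟨c • f, fun k => (hf k).const_smul c, fun g => by simp [hf']⟩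

variable (V) in
/-- The `i`-th term `W_i` of the filtration: those smooth valuations `φ`, as functions of convex
bodies, for which the (one-sided) derivatives of `t ↦ φ(tK + x)`, `t ∈ [0,1]`, of all orders
`k < i` vanish at `t = 0`, for all `K` and `x`. -/
def W (i : ℕ) : Set (ConvexBody V → ℂ) :=
  {φ | (∃ ψ ∈ SV V, QV.incl V ψ = φ) ∧ ∀ k < i, ∀ (K : ConvexBody V) (x : V),
    iteratedDerivWithin k (fun t : ℝ => φ (t • K + point x)) (Icc 0 1) 0 = 0}

variable (V) in
/-- The space `C^∞(V, |ω_V|)` of smooth complex densities on `V`, the density `f(x) dx` being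
represented by its coefficient `f` with respect to a fixed Lebesgue measure `dx`. -/
def smoothDensities : Set (V → ℂ) := {f | ContDiff ℝ ∞ f}

/-- The function `K ↦ ∫_K f(x) dx` of convex bodies given by the density `f(x) dx`, where `dx` is
the Lebesgue measure `μ`. -/
def evalDensity [MeasurableSpace V] (μ : Measure V) (f : V → ℂ) : ConvexBody V → ℂ :=
  fun K => ∫ x in (K : Set V), f x ∂μ

end Affine

end SmoothValuation

end

/-! Substituting z = ty + x, the integral of f over tK + x is t^n ∫_K f(ty + x) dy. Hence its
t-derivatives of order below n vanish at t = 0, and the n-th one is n! μ(K) f(x). This gives the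
filtration condition for densities and tells how to recover f from φ.

A density is also a smooth vector. The affine group moves it through densities whose coefficients
depend smoothly on (A, b), and a smooth family of densities is smooth as a map into `QV V`: the
seminorms only involve derivatives of the integrand over compact sets (`continuous_densityQV`), and
Hadamard's lemma presents the difference quotients themselves as a smooth family
(`isCkOn_densityQV`). Injectivity follows from integrating over small balls.

For surjectivity let φ be in W_n and let Q be the unit cube of a basis. Define f(x) as the n-th
derivative of φ(tQ + x) at t = 0, divided by n! μ(Q). It is smooth in x, being a continuous linear
functional of the translates of φ. Put ψ = φ - ∫ f. By Taylor's formula ψ(tL + x) = O(t^n),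
uniformly for L and x in a compact set, and ψ(tQ + x) = o(t^n).

Such a valuation is zero (`eq_zero_of_small_growth`). Cut K by a grid of side h. The O(h^(-n)) cells
inside K are cubes and contribute o(h^n) each. The boundary of a convex body is null, so only
o(h^(-n)) cells meet it, and each contributes O(h^n). The sections along the cutting hyperplanes are
discarded beforehand: the same count shows that ψ vanishes on bodies of measure zero
(`eq_zero_of_measure_eq_zero`), where a supremum over sub-bodies absorbs the sections. -/

noncomputable section

namespace SmoothValuation

set_option linter.unusedSectionVars false

/-! ### Integrals depending on a parameter -/

section Parametric

variable {X Y E : Type*} [NormedAddCommGroup X] [NormedSpace ℝ X] [FiniteDimensional ℝ X]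
  [NormedAddCommGroup Y] [NormedSpace ℝ Y] [FiniteDimensional ℝ Y]
  [NormedAddCommGroup E] [NormedSpace ℝ E]

/-- The partial derivatives of a smooth function are jointly continuous. -/
lemma continuous_iteratedFDeriv_partial {M : X × Y → E} (hM : ContDiff ℝ ∞ M) (k : ℕ) :
    Continuous fun z : X × Y => iteratedFDeriv ℝ k (fun q => M (q, z.2)) z.1 := by
  -- The slice is a translate of `M` precomposed with `inl`, so its derivatives are the full
  -- derivatives of `M` restricted to the first factor.
  have key : ∀ z : X × Y, iteratedFDeriv ℝ k (fun q => M (q, z.2)) z.1 =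
      ContinuousMultilinearMap.compContinuousLinearMapL
        (fun _ : Fin k => ContinuousLinearMap.inl ℝ X Y) (iteratedFDeriv ℝ k M z) := by
    intro z
    have h1 : (fun q => M (q, z.2)) =
        (fun w => M (w + (0, z.2))) ∘ ContinuousLinearMap.inl ℝ X Y := by
      ext q; simp
    have h2 : ContDiff ℝ ∞ (fun w => M (w + (0, z.2))) := hM.comp (contDiff_id.add contDiff_const)
    rw [h1, (ContinuousLinearMap.inl ℝ X Y).iteratedFDeriv_comp_right h2 _
      (by exact_mod_cast le_top), iteratedFDeriv_comp_add_right]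
    simp
  simp_rw [key]
  exact (ContinuousLinearMap.continuous _).comp
    (hM.continuous_iteratedFDeriv (by exact_mod_cast le_top))

variable [MeasurableSpace Y] [BorelSpace Y] {ν : Measure Y} [IsFiniteMeasureOnCompacts ν]
  {K : Set Y}

lemma integrableOn_slice {N : X × Y → E} (hN : Continuous N) (hK : IsCompact K) (q : X) :
    IntegrableOn (fun y => N (q, y)) K ν :=
  (hN.comp (Continuous.prodMk_right q)).continuousOn.integrableOn_compact hK

/-- Compactness of `K` supplies the domination: a strict bound for `N'` on {q₀} × K persists for all
nearby parameters, and constants are integrable over `K`. -/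
lemma hasFDerivAt_setIntegral (hK : IsCompact K) {N : X × Y → E}
    {N' : X × Y → X →L[ℝ] E} (hN : Continuous N) (hN' : Continuous N')
    (hd : ∀ q y, HasFDerivAt (fun q => N (q, y)) (N' (q, y)) q) (q₀ : X) :
    HasFDerivAt (fun q => ∫ y in K, N (q, y) ∂ν) (∫ y in K, N' (q₀, y) ∂ν) q₀ := by
  obtain ⟨C, hC⟩ := hK.exists_bound_of_continuousOn
    (f := fun y => N' (q₀, y)) (hN'.comp (Continuous.prodMk_right q₀)).continuousOn
  have hev : ∀ᶠ q in 𝓝 q₀, ∀ y ∈ K, ‖N' (q, y)‖ < C + 1 := by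
    refine hK.eventually_forall_of_forall_eventually fun y hy => ?_
    exact hN'.norm.continuousAt.eventually_lt continuousAt_const
      ((hC y hy).trans_lt (lt_add_one C))
  refine hasFDerivAt_integral_of_dominated_of_fderiv_le (𝕜 := ℝ)
    (F := fun q y => N (q, y)) (F' := fun q y => N' (q, y)) (bound := fun _ => C + 1) hev
    (.of_forall fun q => (integrableOn_slice hN hK q).aestronglyMeasurable)
    (integrableOn_slice hN hK q₀) (integrableOn_slice hN' hK q₀).aestronglyMeasurable ?_ ?_ ?_
  · exact (ae_restrict_mem hK.measurableSet).mono fun y hy q hq => (hq y hy).le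
  · exact integrableOn_const hK.measure_lt_top.ne
  · exact .of_forall fun y q _ => hd q y

lemma continuous_setIntegral (hK : IsCompact K) {N : X × Y → E} (hN : Continuous N) :
    Continuous fun q => ∫ y in K, N (q, y) ∂ν :=
  continuous_parametric_integral_of_continuous (f := fun q y => N (q, y)) hN hK

variable [CompleteSpace E]

/-- Each order reduces to differentiation under the integral sign, since integration commutes with
currying. A Taylor series yields both smoothness and the formula for all derivatives, the latter
being what the seminorms of `QV V` require. -/
lemma hasFTaylorSeriesUpTo_setIntegral (hK : IsCompact K) {M : X × Y → E} (hM : ContDiff ℝ ∞ M) :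
    HasFTaylorSeriesUpTo ∞ (fun q => ∫ y in K, M (q, y) ∂ν)
      (fun q k => ∫ y in K, iteratedFDeriv ℝ k (fun q => M (q, y)) q ∂ν) := by
  have hslice : ∀ y, ContDiff ℝ ∞ fun q => M (q, y) := fun y =>
    hM.comp (contDiff_id.prodMk contDiff_const)
  refine ⟨fun q => ?_, fun k _ q => ?_, fun k _ => ?_⟩
  · have h := (continuousMultilinearCurryFin0 ℝ X E).toContinuousLinearEquiv.integral_comp_comm
      (fun y => iteratedFDeriv ℝ 0 (fun q => M (q, y)) q) (μ := ν.restrict K)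
    refine h.symm.trans ?_
    simp
  · have h : ∫ y in K, (iteratedFDeriv ℝ (k + 1) (fun q => M (q, y)) q).curryLeft ∂ν =
        (∫ y in K, iteratedFDeriv ℝ (k + 1) (fun q => M (q, y)) q ∂ν).curryLeft := by
      let L : (X [×(k + 1)]→L[ℝ] E) →L[ℝ] (X →L[ℝ] (X [×k]→L[ℝ] E)) :=
        (continuousMultilinearCurryLeftEquiv ℝ
          (fun _ : Fin (k + 1) => X) E).toContinuousLinearEquiv.toContinuousLinearMap
      exact ContinuousLinearMap.integral_comp_comm (𝕜 := ℝ) (E := X [×(k + 1)]→L[ℝ] E)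
        (Fₗ := X →L[ℝ] (X [×k]→L[ℝ] E)) L (μ := ν.restrict K)
        (integrableOn_slice (continuous_iteratedFDeriv_partial hM (k + 1)) hK q)
    have h2 := hasFDerivAt_setIntegral (ν := ν) hK
      (N := fun z => iteratedFDeriv ℝ k (fun q => M (q, z.2)) z.1)
      (N' := fun z => (iteratedFDeriv ℝ (k + 1) (fun q => M (q, z.2)) z.1).curryLeft)
      (continuous_iteratedFDeriv_partial hM k)
      ((continuousMultilinearCurryLeftEquiv ℝ
        (fun _ : Fin (k + 1) => X) E).continuous.comp (continuous_iteratedFDeriv_partial hM (k + 1)))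
      (fun q y => (contDiff_iff_ftaylorSeries.1 (hslice y)).fderiv k (by
        exact_mod_cast WithTop.coe_lt_top _) q) q
    exact h2.congr_fderiv h
  · exact continuous_setIntegral hK (continuous_iteratedFDeriv_partial hM k)

lemma contDiff_setIntegral (hK : IsCompact K) {M : X × Y → E} (hM : ContDiff ℝ ∞ M) :
    ContDiff ℝ ∞ fun q => ∫ y in K, M (q, y) ∂ν :=
  (hasFTaylorSeriesUpTo_setIntegral hK hM).contDiff

lemma iteratedFDeriv_setIntegral (hK : IsCompact K) {M : X × Y → E} (hM : ContDiff ℝ ∞ M)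
    (k : ℕ) (q : X) :
    iteratedFDeriv ℝ k (fun q => ∫ y in K, M (q, y) ∂ν) q =
      ∫ y in K, iteratedFDeriv ℝ k (fun q => M (q, y)) q ∂ν :=
  ((hasFTaylorSeriesUpTo_setIntegral hK hM).eq_iteratedFDeriv (by exact_mod_cast le_top) q).symm

end Parametric

/-! ### Convergence in measure of convex bodies -/

section Volume

variable {V : Type*} [NormedAddCommGroup V] [NormedSpace ℝ V] [FiniteDimensional ℝ V]

lemma eventually_subset_thickening (K : ConvexBody V) {ε : ℝ} (hε : 0 < ε) :
    ∀ᶠ L : ConvexBody V in 𝓝 K, (L : Set V) ⊆ Metric.thickening ε (K : Set V) := by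
  filter_upwards [Metric.ball_mem_nhds K hε] with L hL x hx
  rw [Metric.mem_ball, ← ConvexBody.hausdorffDist_coe] at hL
  obtain ⟨y, hy, hxy⟩ := Metric.exists_dist_lt_of_hausdorffDist_lt hx hL
    ConvexBody.hausdorffEDist_ne_top
  exact Metric.mem_thickening_iff.2 ⟨y, hy, hxy⟩

/-- An interior point of a convex body belongs to all close convex bodies. -/
lemma eventually_mem_of_mem_interior {K : ConvexBody V} {x : V} (hx : x ∈ interior (K : Set V)) :
    ∀ᶠ L : ConvexBody V in 𝓝 K, x ∈ (L : Set V) := by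
  obtain ⟨r, hr, hball⟩ := Metric.mem_nhds_iff.1 (mem_interior_iff_mem_nhds.1 hx)
  filter_upwards [Metric.ball_mem_nhds K (half_pos hr)] with L hL
  by_contra hxL
  -- If x were outside L, a functional u would separate them. Moving from x by r in a direction
  -- where u grows at rate above ‖u‖ / 2 stays in K, but reaches a point where u exceeds its values
  -- on L by more than r‖u‖ / 2. No point of L is then within r / 2.
  obtain ⟨u, s, hu1, hu2⟩ := geometric_hahn_banach_closed_point L.convex L.isClosed hxL
  have hu0 : 0 < ‖u‖ := by
    rw [norm_pos_iff]
    rintro rfl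
    obtain ⟨y, hy⟩ := L.nonempty
    have := (hu1 y hy).trans hu2
    simp at this
  obtain ⟨e, he, hue⟩ : ∃ e : V, ‖e‖ < 1 ∧ ‖u‖ / 2 < u e := by
    obtain ⟨e, he1, he2⟩ := u.exists_lt_apply_of_lt_opNorm (half_lt_self hu0)
    rcases le_total 0 (u e) with h | h
    · exact ⟨e, he1, by rwa [Real.norm_of_nonneg h] at he2⟩
    · exact ⟨-e, by rwa [norm_neg], by rw [map_neg]; rwa [Real.norm_of_nonpos h] at he2⟩
  have hz : x + r • e ∈ (K : Set V) := by
    apply hball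
    rw [Metric.mem_ball, dist_self_add_left, norm_smul, Real.norm_of_nonneg hr.le]
    nlinarith
  rw [Metric.mem_ball, ← ConvexBody.hausdorffDist_coe] at hL
  obtain ⟨y, hy, hxy⟩ := Metric.exists_dist_lt_of_hausdorffDist_lt' hz hL
    ConvexBody.hausdorffEDist_ne_top
  have h1 : u (x + r • e - y) ≤ ‖u‖ * (r / 2) := by
    refine (le_abs_self _).trans ((u.le_opNorm _).trans ?_)
    rw [dist_comm, dist_eq_norm] at hxy
    gcongr
  have h2 := hu1 y hy
  simp only [map_sub, map_add, map_smul, smul_eq_mul] at h1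
  nlinarith [mul_lt_mul_of_pos_left hue hr]

variable [MeasurableSpace V] [BorelSpace V] (μ : Measure V) [μ.IsAddHaarMeasure]

/-- Close convex bodies have symmetric difference of small measure. -/
lemma eventually_measureReal_sdiff_lt (K : ConvexBody V) {ε : ℝ} (hε : 0 < ε) :
    ∀ᶠ L : ConvexBody V in 𝓝 K,
      μ.real ((L : Set V) \ K) + μ.real ((K : Set V) \ L) < ε := by
  let B : Set V := Metric.cthickening 1 (K : Set V)
  have hB : IsCompact B := K.isCompact.cthickening
  have hmK : MeasurableSet (K : Set V) := K.isClosed.measurableSet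
  -- Dominated convergence on a compact neighbourhood of K: off the frontier, which is null by
  -- convexity, a point eventually lies in both L and K or in neither.
  have key : Tendsto (fun L : ConvexBody V => ∫ x in B,
      ((((L : Set V) \ K).indicator (fun _ => (1 : ℝ)) x) +
        (((K : Set V) \ L).indicator (fun _ => (1 : ℝ)) x)) ∂μ) (𝓝 K) (𝓝 (∫ x in B, 0 ∂μ)) := by
    refine tendsto_integral_filter_of_dominated_convergence (fun _ => 2) ?_ ?_ ?_ ?_
    · refine .of_forall fun L => ?_
      have hmL : MeasurableSet (L : Set V) := L.isClosed.measurableSet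
      exact ((measurable_const.indicator (hmL.diff hmK)).add
        (measurable_const.indicator (hmK.diff hmL))).aestronglyMeasurable
    · refine .of_forall fun L => .of_forall fun x => ?_
      rw [Real.norm_eq_abs]
      by_cases h1 : x ∈ (L : Set V) <;> by_cases h2 : x ∈ (K : Set V) <;> simp [indicator, h1, h2]
    · exact integrableOn_const hB.measure_lt_top.ne
    · have hfr : ∀ᵐ x ∂μ.restrict B, x ∉ frontier (K : Set V) :=
        ae_restrict_of_ae (measure_eq_zero_iff_ae_notMem.1 (K.convex.addHaar_frontier μ))
      filter_upwards [hfr] with x hx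
      refine tendsto_const_nhds.congr' ?_
      by_cases hxK : x ∈ (K : Set V)
      · have hxi : x ∈ interior (K : Set V) := by
          by_contra h
          exact hx ⟨subset_closure hxK, h⟩
        filter_upwards [eventually_mem_of_mem_interior hxi] with L hL
        simp [indicator, hL, hxK]
      · have hpos : 0 < Metric.infDist x (K : Set V) :=
          (K.isClosed.notMem_iff_infDist_pos K.nonempty).1 hxK
        filter_upwards [eventually_subset_thickening K hpos] with L hL
        have hxL : x ∉ (L : Set V) := fun h => by
          obtain ⟨y, hy, hd⟩ := Metric.mem_thickening_iff.1 (hL h)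
          exact (Metric.infDist_le_dist_of_mem hy).not_gt hd
        simp [indicator, hxL, hxK]
  simp only [integral_zero] at key
  filter_upwards [key.eventually_lt_const hε, eventually_subset_thickening K one_pos] with L h1 h2
  have hLB : (L : Set V) ⊆ B := h2.trans (Metric.thickening_subset_cthickening _ _)
  have hKB : (K : Set V) ⊆ B := Metric.self_subset_cthickening _
  have hmL : MeasurableSet (L : Set V) := L.isClosed.measurableSet
  rw [integral_add, integral_indicator_const _ (hmL.diff hmK),
    integral_indicator_const _ (hmK.diff hmL), measureReal_restrict_apply (hmL.diff hmK),
    measureReal_restrict_apply (hmK.diff hmL),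
    inter_eq_left.2 (sdiff_subset.trans hLB), inter_eq_left.2 (sdiff_subset.trans hKB)] at h1
  · simpa using h1
  · exact (integrableOn_const hB.measure_lt_top.ne (by simp)).indicator (hmL.diff hmK)
  · exact (integrableOn_const hB.measure_lt_top.ne (by simp)).indicator (hmK.diff hmL)

variable {E : Type*} [NormedAddCommGroup E] [NormedSpace ℝ E]

lemma norm_setIntegral_sub_le {K L : ConvexBody V} {g : V → E} (hg : Continuous g) {C : ℝ}
    (hC : ∀ x ∈ (K : Set V) ∪ L, ‖g x‖ ≤ C) :
    ‖∫ x in (L : Set V), g x ∂μ - ∫ x in (K : Set V), g x ∂μ‖ ≤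
      C * (μ.real ((L : Set V) \ K) + μ.real ((K : Set V) \ L)) := by
  have hmK : MeasurableSet (K : Set V) := K.isClosed.measurableSet
  have hmL : MeasurableSet (L : Set V) := L.isClosed.measurableSet
  have hiK : IntegrableOn g K μ := hg.continuousOn.integrableOn_compact K.isCompact
  have hiL : IntegrableOn g L μ := hg.continuousOn.integrableOn_compact L.isCompact
  have h1 := integral_inter_add_sdiff hmK hiL
  have h2 := integral_inter_add_sdiff hmL hiK
  rw [inter_comm] at h2
  rw [← h1, ← h2, add_sub_add_left_eq_sub, mul_add]
  refine (norm_sub_le _ _).trans (add_le_add ?_ ?_)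
  · exact norm_setIntegral_le_of_norm_le_const
      ((measure_mono sdiff_subset).trans_lt L.isCompact.measure_lt_top)
      fun x hx => hC x (Or.inr hx.1)
  · exact norm_setIntegral_le_of_norm_le_const
      ((measure_mono sdiff_subset).trans_lt K.isCompact.measure_lt_top)
      fun x hx => hC x (Or.inl hx.1)

end Volume

/-! ### Densities as quasi-smooth valuations -/

section Densities

variable {V : Type*} [NormedAddCommGroup V] [NormedSpace ℝ V] [FiniteDimensional ℝ V]
  [MeasurableSpace V] [BorelSpace V] (μ : Measure V) [μ.IsAddHaarMeasure]

/-- All bodies near K lie in one compact neighbourhood of K. There `N` is bounded uniformly in z ∈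
C, so the integrals differ by at most a constant times the measure of the symmetric difference. -/
lemma tendstoUniformlyOn_setIntegral {Z E : Type*} [TopologicalSpace Z]
    [NormedAddCommGroup E] [NormedSpace ℝ E] {N : Z × V → E} (hN : Continuous N)
    (K : ConvexBody V) {C : Set Z} (hC : IsCompact C) :
    TendstoUniformlyOn (fun (L : ConvexBody V) z => ∫ y in (L : Set V), N (z, y) ∂μ)
      (fun z => ∫ y in (K : Set V), N (z, y) ∂μ) (𝓝 K) C := by
  rw [Metric.tendstoUniformlyOn_iff]
  intro ε hε
  obtain ⟨B, hB⟩ := (hC.prod (K.isCompact.cthickening (r := 1))).exists_bound_of_continuousOn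
    hN.continuousOn
  have hB' : 0 < |B| + 1 := by positivity
  filter_upwards [eventually_measureReal_sdiff_lt μ K (div_pos hε hB'),
    eventually_subset_thickening K one_pos] with L hL hLK z hz
  rw [dist_comm, dist_eq_norm]
  have hsub : (K : Set V) ∪ L ⊆ Metric.cthickening 1 (K : Set V) :=
    union_subset (Metric.self_subset_cthickening _)
      (hLK.trans (Metric.thickening_subset_cthickening _ _))
  refine (norm_setIntegral_sub_le μ (hN.comp (Continuous.prodMk_right z)) (C := |B| + 1)
    fun x hx => ?_).trans_lt ?_
  · have := hB (z, x) ⟨hz, hsub hx⟩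
    have := le_abs_self B
    simp only [Function.comp]
    linarith
  · rwa [lt_div_iff₀' hB'] at hL

open scoped Pointwise in
/-- The substitution `z = ty + x` in an integral over `tK + x`. -/
lemma scaleTranslate_evalDensity (f : V → ℂ) (K : ConvexBody V) {p : ℝ × V} (hp : p ∈ strip V) :
    scaleTranslate (evalDensity μ f) K p =
      ∫ y in (K : Set V), p.1 ^ Module.finrank ℝ V • f (p.1 • y + p.2) ∂μ := by
  obtain ⟨t, x⟩ := p
  have ht : 0 ≤ t := hp.1.1
  have himg : ((t • K + point x : ConvexBody V) : Set V) = (fun y => t • y + x) '' K := by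
    change t • (K : Set V) + {x} = _
    rw [add_singleton, ← image_smul, image_image]
  simp only [scaleTranslate, evalDensity]
  rw [himg]
  -- For t = 0 the substitution degenerates. The image is the point x, which is null when n > 0, in
  -- agreement with 0 ^ n = 0; when n = 0 the space is a single point and 0 ^ 0 = 1.
  rcases ht.eq_or_lt with rfl | ht
  · rcases Nat.eq_zero_or_pos (Module.finrank ℝ V) with h0 | h0
    · have : Subsingleton V := Module.finrank_zero_iff.1 h0
      have h1 : (fun y : V => (0 : ℝ) • y + x) '' K = K := by
        have : (fun y : V => (0 : ℝ) • y + x) = id := Subsingleton.elim _ _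
        rw [this, image_id]
      rw [h1, h0]
      refine setIntegral_congr_fun K.isClosed.measurableSet fun y _ => ?_
      simp [Subsingleton.elim x y]
    · have : Nontrivial V := Module.finrank_pos_iff.1 h0
      have h1 : (fun y : V => (0 : ℝ) • y + x) '' K = {x} := by
        simp [K.nonempty]
      rw [h1, setIntegral_measure_zero _ (measure_singleton x)]
      simp [h0.ne']
  · rw [integral_image_eq_integral_abs_det_fderiv_smul μ K.isClosed.measurableSet
      (f' := fun _ => t • ContinuousLinearMap.id ℝ V)]
    · refine setIntegral_congr_fun K.isClosed.measurableSet fun y _ => ?_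
      have : (t • ContinuousLinearMap.id ℝ V).det = t ^ Module.finrank ℝ V := by
        rw [ContinuousLinearMap.det, ContinuousLinearMap.toLinearMap_smul, LinearMap.det_smul]
        simp
      simp only [this, abs_of_pos (pow_pos ht _)]
    · intro y _
      exact (((hasFDerivAt_id y).const_smul t).add_const x).hasFDerivWithinAt
    · intro y _ z _ hyz
      simpa [ht.ne'] using hyz

lemma contDiff_scaleTranslate_integrand {X : Type*} [NormedAddCommGroup X] [NormedSpace ℝ X]
    {H : X × V → ℂ} (hH : ContDiff ℝ ∞ H) :
    ContDiff ℝ ∞ fun z : (ℝ × V) × (X × V) =>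
      z.1.1 ^ Module.finrank ℝ V • H (z.2.1, z.1.1 • z.2.2 + z.1.2) := by
  fun_prop

lemma contDiff_scaleTranslate_integrand' {f : V → ℂ} (hf : ContDiff ℝ ∞ f) :
    ContDiff ℝ ∞ fun z : (ℝ × V) × V =>
      z.1.1 ^ Module.finrank ℝ V • f (z.1.1 • z.2 + z.1.2) := by
  fun_prop

lemma contDiffOn_scaleTranslate_evalDensity {f : V → ℂ} (hf : ContDiff ℝ ∞ f) (K : ConvexBody V) :
    ContDiffOn ℝ ∞ (scaleTranslate (evalDensity μ f) K) (strip V) :=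
  (contDiff_setIntegral (ν := μ) K.isCompact
    (contDiff_scaleTranslate_integrand' hf)).contDiffOn.congr
    fun _ hp => scaleTranslate_evalDensity μ f K hp

lemma stDeriv_evalDensity {f : V → ℂ} (hf : ContDiff ℝ ∞ f) (K : ConvexBody V) (k : ℕ)
    {p : ℝ × V} (hp : p ∈ strip V) :
    stDeriv k (evalDensity μ f) K p = ∫ y in (K : Set V), iteratedFDeriv ℝ k
      (fun q : ℝ × V => q.1 ^ Module.finrank ℝ V • f (q.1 • y + q.2)) p ∂μ := by
  have hM := contDiff_scaleTranslate_integrand' hf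
  have h1 := contDiff_setIntegral (ν := μ) K.isCompact hM
  unfold stDeriv
  rw [iteratedFDerivWithin_congr (fun q hq => scaleTranslate_evalDensity μ f K hq) hp,
    iteratedFDerivWithin_eq_iteratedFDeriv uniqueDiffOn_strip
      (h1.of_le (by exact_mod_cast le_top)).contDiffAt hp]
  exact iteratedFDeriv_setIntegral K.isCompact hM k p

lemma isQuasiSmooth_evalDensity {f : V → ℂ} (hf : ContDiff ℝ ∞ f) :
    IsQuasiSmooth (evalDensity μ f) := by
  refine ⟨?_, ?_, fun K => (contDiffOn_scaleTranslate_evalDensity μ hf K).of_le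
    (by exact_mod_cast le_top), ?_⟩
  · intro K L M N hM hN
    have hmL : MeasurableSet (L : Set V) := L.isClosed.measurableSet
    have hi : ∀ A : ConvexBody V, IntegrableOn f A μ := fun A =>
      hf.continuous.continuousOn.integrableOn_compact A.isCompact
    -- M and K are both split along L: their parts outside L coincide, and their parts inside L are
    -- L and N.
    have h1 := integral_inter_add_sdiff hmL (hi M)
    have h2 := integral_inter_add_sdiff hmL (hi K)
    have h3 : (M : Set V) ∩ L = L := by rw [hM]; exact union_inter_cancel_right
    have h4 : (M : Set V) \ L = (K : Set V) \ L := by rw [hM]; exact union_sdiff_right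
    rw [h3, h4] at h1
    rw [← hN] at h2
    simp only [evalDensity]
    rw [← h1, ← h2]
    ring
  · rw [continuous_iff_continuousAt]
    intro K
    have h := tendstoUniformlyOn_setIntegral μ (Z := Unit) (N := fun z => f z.2)
      (hf.continuous.comp continuous_snd) K isCompact_univ
    exact h.tendsto_at (mem_univ ())
  · intro K G hG k hk
    have h := tendstoUniformlyOn_setIntegral μ
      (continuous_iteratedFDeriv_partial (contDiff_scaleTranslate_integrand' hf) k) K
      ((isCompact_Icc (a := (0 : ℝ)) (b := 1)).prod hG)
    refine (h.congr (.of_forall fun L p hp => ?_)).congr_right fun p hp => ?_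
    · exact (stDeriv_evalDensity μ hf L k (prod_subset_strip G hp)).symm
    · exact (stDeriv_evalDensity μ hf K k (prod_subset_strip G hp)).symm

/-- A quasi-smooth function of convex bodies as an element of `QV(V)`. -/
def QV.ofIsQuasiSmooth (φ : ConvexBody V → ℂ) (hφ : IsQuasiSmooth φ) : QV V := ⟨φ, hφ⟩

open Classical in
/-- The quasi-smooth valuation `K ↦ ∫_K f` (zero if `f` is not smooth). -/
def densityQV (f : V → ℂ) : QV V :=
  if hf : ContDiff ℝ ∞ f then .ofIsQuasiSmooth _ (isQuasiSmooth_evalDensity μ hf) else 0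

lemma incl_densityQV {f : V → ℂ} (hf : ContDiff ℝ ∞ f) :
    QV.incl V (densityQV μ f) = evalDensity μ f := by
  rw [densityQV, dif_pos hf]; rfl

lemma incl_injective : Function.Injective (QV.incl V) := Subtype.val_injective

lemma incl_real_smul (c : ℝ) (φ : QV V) : QV.incl V (c • φ) = c • QV.incl V φ := rfl

lemma evalDensity_sub {f g : V → ℂ} (hf : Continuous f) (hg : Continuous g) :
    evalDensity μ (f - g) = evalDensity μ f - evalDensity μ g := by
  funext K
  exact integral_sub (hf.continuousOn.integrableOn_compact K.isCompact)
    (hg.continuousOn.integrableOn_compact K.isCompact)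

lemma evalDensity_const_smul (c : ℝ) (f : V → ℂ) :
    evalDensity μ (c • f) = c • evalDensity μ f := by
  funext K
  exact integral_smul c f

/-- A smooth family of densities is continuous in the topology of `QV(V)`. -/
lemma continuous_densityQV {X : Type*} [NormedAddCommGroup X] [NormedSpace ℝ X]
    [FiniteDimensional ℝ X] {H : X × V → ℂ} (hH : ContDiff ℝ ∞ H) :
    Continuous fun p => densityQV μ fun y => H (p, y) := by
  have hslice : ∀ p, ContDiff ℝ ∞ fun y => H (p, y) := fun p =>
    hH.comp (contDiff_const.prodMk contDiff_id)
  rw [continuous_iff_continuousAt]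
  intro p₀
  refine (withSeminorms_QV.tendsto_nhds _ _).2 fun G ε hε => ?_
  have hG := G.isCompact
  -- `m` bounds the measure of every body in `G` and is positive even if `G` is null; integrands
  -- within ε / 2 / m of each other then suffice.
  obtain ⟨m, hm0, hm⟩ : ∃ m : ℝ, 0 < m ∧ μ.real (G : Set V) < m :=
    ⟨μ.real (G : Set V) + 1, by positivity, lt_add_one _⟩
  have hδ : 0 < ε / 2 / m := by positivity
  have hcont : ∀ k : ℕ, Continuous fun z : (ℝ × V) × (X × V) =>
      iteratedFDeriv ℝ k (fun q : ℝ × V =>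
        q.1 ^ Module.finrank ℝ V • H (z.2.1, q.1 • z.2.2 + q.2)) z.1 := fun k =>
    continuous_iteratedFDeriv_partial (contDiff_scaleTranslate_integrand hH) k
  let N : ℕ → X → (ℝ × V) × V → ℝ := fun k p z => ‖iteratedFDeriv ℝ k (fun q : ℝ × V =>
        q.1 ^ Module.finrank ℝ V • H (p, q.1 • z.2 + q.2)) z.1 -
      iteratedFDeriv ℝ k (fun q : ℝ × V =>
        q.1 ^ Module.finrank ℝ V • H (p₀, q.1 • z.2 + q.2)) z.1‖
  have hN : ∀ k, Continuous fun w : X × ((ℝ × V) × V) => N k w.1 w.2 := fun k =>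
    (((hcont k).comp (by fun_prop : Continuous fun w : X × ((ℝ × V) × V) =>
      (w.2.1, (w.1, w.2.2)))).sub ((hcont k).comp
        (by fun_prop : Continuous fun w : X × ((ℝ × V) × V) => (w.2.1, (p₀, w.2.2))))).norm
  -- Compactness of [0,1] × G × G makes the closeness of the integrands uniform in the point (t, x)
  -- and in the integration variable.
  have hev : ∀ᶠ p in 𝓝 p₀, ∀ k ∈ Finset.range (Module.finrank ℝ V + 1),
      ∀ z ∈ (Icc (0 : ℝ) 1 ×ˢ (G : Set V)) ×ˢ (G : Set V), N k p z < ε / 2 / m := by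
    rw [Filter.eventually_all_finset]
    intro k _
    refine ((isCompact_Icc.prod hG).prod hG).eventually_forall_of_forall_eventually
      fun z _ => ?_
    refine (hN k).continuousAt.eventually_lt continuousAt_const ?_
    simpa [N] using hδ
  filter_upwards [hev] with p hp
  -- The seminorm is a supremum, which only inherits a weak inequality; hence the spare factor 1 /
  -- 2.
  refine lt_of_le_of_lt ?_ (half_lt_self hε)
  refine Real.iSup_le (fun q => ?_) (by positivity)
  obtain ⟨⟨K, k, z⟩, hK, hk, hz⟩ := q
  simp only at hK hk hz
  have hzs := prod_subset_strip _ hz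
  have hsub : (fun y => H (p, y)) - (fun y => H (p₀, y)) = fun y => H (p, y) - H (p₀, y) := rfl
  have hi : ∀ p, IntegrableOn (fun y => iteratedFDeriv ℝ k (fun q : ℝ × V =>
        q.1 ^ Module.finrank ℝ V • H (p, q.1 • y + q.2)) z) K μ := fun p =>
    ((hcont k).comp (by fun_prop : Continuous fun y : V =>
      (z, (p, y)))).continuousOn.integrableOn_compact K.isCompact
  have hst : stDeriv k (QV.incl V ((densityQV μ fun y => H (p, y)) -
      densityQV μ fun y => H (p₀, y))) K z =
      stDeriv k (evalDensity μ fun y => H (p, y)) K z -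
        stDeriv k (evalDensity μ fun y => H (p₀, y)) K z := by
    rw [map_sub, incl_densityQV μ (hslice p), incl_densityQV μ (hslice p₀)]
    exact iteratedFDerivWithin_sub_apply
      (((contDiffOn_scaleTranslate_evalDensity μ (hslice p) K) z hzs).of_le
        (by exact_mod_cast le_top))
      (((contDiffOn_scaleTranslate_evalDensity μ (hslice p₀) K) z hzs).of_le
        (by exact_mod_cast le_top)) uniqueDiffOn_strip hzs
  change ‖stDeriv k (QV.incl V _) K z‖ ≤ _
  rw [hst, stDeriv_evalDensity μ (hslice p) K k hzs, stDeriv_evalDensity μ (hslice p₀) K k hzs,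
    ← integral_sub (hi p) (hi p₀)]
  refine (norm_setIntegral_le_of_norm_le_const (C := ε / 2 / m) K.isCompact.measure_lt_top
    fun y hy => ?_).trans ?_
  · exact (hp k (Finset.mem_range.2 (Nat.lt_succ_of_le hk)) (z, y) ⟨hz, hK hy⟩).le
  · have : μ.real (K : Set V) ≤ m :=
      (measureReal_mono hK hG.measure_lt_top.ne).trans hm.le
    calc ε / 2 / m * μ.real (K : Set V) ≤ ε / 2 / m * m := by gcongr
      _ = ε / 2 := by field_simp

end Densities

/-! ### Smooth families of densities -/

section SmoothFamilies

variable {V : Type*} [NormedAddCommGroup V] [NormedSpace ℝ V] [FiniteDimensional ℝ V]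
  {X : Type*} [NormedAddCommGroup X] [NormedSpace ℝ X] [FiniteDimensional ℝ X]

/-- Near a given parameter, a smooth family of functions defined on an open set of parameters
coincides with a globally smooth family. -/
lemma exists_contDiff_eventually_eq {U : Set X} (hU : IsOpen U) {H : X × V → ℂ}
    (hH : ContDiffOn ℝ ∞ H (U ×ˢ univ)) {x : X} (hx : x ∈ U) :
    ∃ H' : X × V → ℂ, ContDiff ℝ ∞ H' ∧ ∀ᶠ p in 𝓝 x, ∀ y, H' (p, y) = H (p, y) := by
  obtain ⟨δ, hδ, hball⟩ := Metric.isOpen_iff.1 hU x hx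
  -- The bump function is 1 near x and supported well inside U, so its product with H is smooth
  -- across the boundary of U.
  let χ : ContDiffBump x := ⟨δ / 4, δ / 2, by positivity, by linarith⟩
  refine ⟨fun z => χ z.1 • H z, ?_, ?_⟩
  · rw [contDiff_iff_contDiffAt]
    intro z
    by_cases hz : z.1 ∈ U
    · have h1 : ContDiffAt ℝ ∞ H z :=
        hH.contDiffAt ((hU.prod isOpen_univ).mem_nhds ⟨hz, mem_univ _⟩)
      exact (χ.contDiff.comp contDiff_fst).contDiffAt.smul h1
    · have h0 : (fun z : X × V => χ z.1 • H z) =ᶠ[𝓝 z] fun _ => 0 := by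
        have hn : z.1 ∉ Metric.closedBall x (δ / 2) := fun h =>
          hz (hball (Metric.closedBall_subset_ball (by linarith) h))
        filter_upwards [continuous_fst.continuousAt.eventually
          (Metric.isClosed_closedBall.isOpen_compl.mem_nhds hn)] with w hw
        have : χ w.1 = 0 := χ.zero_of_le_dist (not_le.1 hw).le
        rw [this, zero_smul]
      exact contDiffAt_const.congr_of_eventuallyEq h0
  · filter_upwards [χ.eventuallyEq_one] with p hp y
    simp only [Pi.one_apply] at hp
    simp [hp]

/-- Hadamard's lemma for smooth families of functions. -/
lemma exists_contDiff_difference_quotient {H : X × V → ℂ} (hH : ContDiff ℝ ∞ H) (x v : X) :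
    ∃ G : ℝ × V → ℂ, ContDiff ℝ ∞ G ∧ (∀ y, G (0, y) = fderiv ℝ H (x, y) (v, 0)) ∧
      ∀ t y, t • G (t, y) = H (x + t • v, y) - H (x, y) := by
  -- The quotient is the average over s ∈ [0,1] of the derivative of H along v at x + stv, a formula
  -- that stays smooth at t = 0.
  let M : (ℝ × V) × ℝ → ℂ := fun z => fderiv ℝ H (x + (z.2 * z.1.1) • v, z.1.2) (v, 0)
  have hfd : ContDiff ℝ ∞ (fderiv ℝ H) := hH.fderiv_right (by exact_mod_cast le_rfl)
  have hM : ContDiff ℝ ∞ M :=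
    (hfd.comp (by fun_prop : ContDiff ℝ ∞ fun z : (ℝ × V) × ℝ =>
      (x + (z.2 * z.1.1) • v, z.1.2))).clm_apply contDiff_const
  refine ⟨fun q => ∫ s in Icc (0 : ℝ) 1, M (q, s), contDiff_setIntegral isCompact_Icc hM,
    fun y => by simp [M], fun t y => ?_⟩
  have hderiv : ∀ s ∈ uIcc (0 : ℝ) 1, HasDerivAt (fun s : ℝ => H (x + (s * t) • v, y))
      (t • M ((t, y), s)) s := by
    intro s _
    have h1 : HasDerivAt (fun s : ℝ => (x + (s * t) • v, y)) (t • v, (0 : V)) s := by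
      refine HasDerivAt.prodMk ?_ (hasDerivAt_const _ _)
      simpa using (((hasDerivAt_id s).mul_const t).smul_const v).const_add x
    have h2 := ((hH.differentiable (by simp)) (x + (s * t) • v, y)).hasFDerivAt.comp_hasDerivAt s h1
    have h3 : ((t • v, (0 : V)) : X × V) = t • (v, 0) := by simp
    rw [h3, map_smul] at h2
    exact h2
  have hint : IntervalIntegrable (fun s => t • M ((t, y), s)) volume 0 1 := by
    apply Continuous.intervalIntegrable
    exact (hM.continuous.comp (Continuous.prodMk_right (t, y))).const_smul t
  have := intervalIntegral.integral_eq_sub_of_hasDerivAt hderiv hint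
  rw [intervalIntegral.integral_smul, intervalIntegral.integral_of_le zero_le_one,
    ← integral_Icc_eq_integral_Ioc] at this
  simpa using this

variable [MeasurableSpace V] [BorelSpace V] (μ : Measure V) [μ.IsAddHaarMeasure]

lemma contDiff_slice {U : Set X} {H : X × V → ℂ} (hH : ContDiffOn ℝ ∞ H (U ×ˢ univ))
    {x : X} (hx : x ∈ U) : ContDiff ℝ ∞ fun y => H (x, y) := by
  rw [← contDiffOn_univ]
  exact hH.comp (contDiff_const.prodMk contDiff_id).contDiffOn fun y _ => ⟨hx, mem_univ _⟩

lemma continuousOn_densityQV {U : Set X} (hU : IsOpen U) {H : X × V → ℂ}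
    (hH : ContDiffOn ℝ ∞ H (U ×ˢ univ)) :
    ContinuousOn (fun p => densityQV μ fun y => H (p, y)) U := by
  intro x hx
  obtain ⟨H', hH', heq⟩ := exists_contDiff_eventually_eq hU hH hx
  refine ((continuous_densityQV μ hH').continuousAt.congr ?_).continuousWithinAt
  filter_upwards [heq] with p hp
  simp only [hp]

/-- By Hadamard's lemma the difference quotient for small t ≠ 0 is the density of a family `G (t,
·)` that is smooth through t = 0. The limit is thus an instance of continuity of smooth families in
`QV V`. -/
lemma tendsto_densityQV_difference_quotient {U : Set X} (hU : IsOpen U) {H : X × V → ℂ}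
    (hH : ContDiffOn ℝ ∞ H (U ×ˢ univ)) {x : X} (hx : x ∈ U) (v : X) :
    Tendsto (fun t : ℝ => t⁻¹ • ((densityQV μ fun y => H (x + t • v, y)) -
      densityQV μ fun y => H (x, y))) (𝓝[≠] 0)
      (𝓝 (densityQV μ fun y => fderiv ℝ H (x, y) (v, 0))) := by
  obtain ⟨H', hH', heq⟩ := exists_contDiff_eventually_eq hU hH hx
  obtain ⟨G, hG, hG0, hGt⟩ := exists_contDiff_difference_quotient hH' x v
  have hfd : ∀ y, fderiv ℝ H (x, y) = fderiv ℝ H' (x, y) := by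
    intro y
    refine Filter.EventuallyEq.fderiv_eq ?_
    filter_upwards [continuous_fst.continuousAt.eventually heq] with z hz
    exact (hz z.2).symm
  have h1 : (fun y => fderiv ℝ H (x, y) (v, 0)) = fun y => G (0, y) := by
    funext y
    rw [hG0, hfd]
  rw [h1]
  have h2 : Tendsto (fun t : ℝ => densityQV μ fun y => G (t, y)) (𝓝[≠] 0)
      (𝓝 (densityQV μ fun y => G (0, y))) :=
    (continuous_densityQV μ hG).continuousAt.tendsto.mono_left nhdsWithin_le_nhds
  refine h2.congr' ?_
  have hline : Tendsto (fun t : ℝ => x + t • v) (𝓝[≠] 0) (𝓝 x) := by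
    have : Continuous fun t : ℝ => x + t • v := by fun_prop
    simpa using (this.tendsto 0).mono_left nhdsWithin_le_nhds
  filter_upwards [hline.eventually heq, self_mem_nhdsWithin] with t ht ht0
  have ht0 : t ≠ 0 := ht0
  have hx0 := heq.self_of_nhds
  have hs1 : ContDiff ℝ ∞ fun y => H (x + t • v, y) := by
    simp only [← ht]
    exact hH'.comp (contDiff_const.prodMk contDiff_id)
  have hs2 : ContDiff ℝ ∞ fun y => H (x, y) := contDiff_slice hH hx
  have hs3 : ContDiff ℝ ∞ fun y => G (t, y) := hG.comp (contDiff_const.prodMk contDiff_id)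
  apply incl_injective
  rw [incl_real_smul, map_sub, incl_densityQV μ hs1, incl_densityQV μ hs2, incl_densityQV μ hs3,
    ← evalDensity_sub μ hs1.continuous hs2.continuous, ← evalDensity_const_smul]
  congr 1
  funext y
  simp only [Pi.smul_apply, Pi.sub_apply]
  rw [← ht, ← hx0, ← hGt, smul_smul, inv_mul_cancel₀ ht0, one_smul]

/-- Smooth families of densities are smooth in the topology of `QV(V)`. -/
lemma isCkOn_densityQV {U : Set X} (hU : IsOpen U) (k : ℕ) {H : X × V → ℂ}
    (hH : ContDiffOn ℝ ∞ H (U ×ˢ univ)) :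
    IsCkOn U k fun p => densityQV μ fun y => H (p, y) := by
  induction k generalizing H with
  | zero => exact continuousOn_densityQV μ hU hH
  | succ k ih =>
    refine ⟨continuousOn_densityQV μ hU hH, fun v =>
      ⟨fun p => densityQV μ fun y => fderiv ℝ H (p, y) (v, 0),
      fun x hx => tendsto_densityQV_difference_quotient μ hU hH hx v,
      ih (H := fun z => fderiv ℝ H z (v, 0)) ?_⟩⟩
    exact (hH.fderiv_of_isOpen (hU.prod isOpen_univ) (by exact_mod_cast le_rfl)).clm_apply
      contDiffOn_const

end SmoothFamilies

/-! ### The action of the affine group on densities -/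

section AffineAction

variable {V : Type*} [NormedAddCommGroup V] [NormedSpace ℝ V] [FiniteDimensional ℝ V]

lemma contDiff_continuousLinearMap_det : ContDiff ℝ ∞ fun A : V →L[ℝ] V => A.det := by
  let b := Module.finBasis ℝ V
  have h : (fun A : V →L[ℝ] V => A.det) = fun A : V →L[ℝ] V =>
      ∑ σ : Equiv.Perm (Fin (Module.finrank ℝ V)), Equiv.Perm.sign σ •
        ∏ i, b.equivFunL (A (b i)) (σ i) := by
    funext A
    rw [ContinuousLinearMap.det, ← LinearMap.det_toMatrix b, Matrix.det_apply]
    simp [LinearMap.toMatrix_apply]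
  rw [h]
  refine ContDiff.sum fun σ _ => ?_
  have : ContDiff ℝ ∞ fun A : V →L[ℝ] V => ∏ i, b.equivFunL (A (b i)) (σ i) := by
    refine contDiff_prod fun i _ => ?_
    exact (contDiff_apply ℝ ℝ (σ i)).comp
      (b.equivFunL.contDiff.comp (contDiff_id.clm_apply contDiff_const))
  exact this.const_smul _

/-- The density `gf`, `g = (A, b)`. -/
def affPushforward (f : V → ℂ) (z : ((V →L[ℝ] V) × V) × V) : ℂ :=
  |z.1.1.det|⁻¹ • f (Ring.inverse z.1.1 (z.2 - z.1.2))

lemma isOpen_affChart : IsOpen {p : (V →L[ℝ] V) × V | IsUnit p.1} :=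
  Units.isOpen.preimage continuous_fst

/-- Where A is invertible, inversion is smooth, and so is |det A|⁻¹, the absolute value being taken
away from 0. -/
lemma contDiffOn_affPushforward {f : V → ℂ} (hf : ContDiff ℝ ∞ f) :
    ContDiffOn ℝ ∞ (affPushforward f) ({p | IsUnit p.1} ×ˢ univ) := by
  rintro z ⟨hz, -⟩
  obtain ⟨u, hu⟩ : IsUnit z.1.1 := hz
  refine ContDiffAt.contDiffWithinAt ?_
  have hdet : z.1.1.det ≠ 0 := by
    have h1 : IsUnit (z.1.1 : V →ₗ[ℝ] V) := by
      rw [← hu]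
      exact u.isUnit.map (ContinuousLinearMap.toLinearMapRingHom : (V →L[ℝ] V) →+* (V →ₗ[ℝ] V))
    exact (h1.map LinearMap.det).ne_zero
  have h1 : ContDiffAt ℝ ∞ (fun z : ((V →L[ℝ] V) × V) × V => |z.1.1.det|⁻¹) z := by
    refine ContDiffAt.inv ?_ (abs_ne_zero.2 hdet)
    exact (contDiffAt_abs hdet).comp z (contDiff_continuousLinearMap_det.comp
      (contDiff_fst.comp contDiff_fst)).contDiffAt
  have h2 : ContDiffAt ℝ ∞ (fun z : ((V →L[ℝ] V) × V) × V => Ring.inverse z.1.1) z := by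
    have := contDiffAt_ringInverse ℝ (n := ∞) u
    rw [hu] at this
    exact this.comp z (contDiff_fst.comp contDiff_fst).contDiffAt
  refine h1.smul (hf.contDiffAt.comp z (h2.clm_apply ?_))
  fun_prop

variable [MeasurableSpace V] [BorelSpace V] (μ : Measure V) [μ.IsAddHaarMeasure]

/-- Change of variables along g⁻¹ : y ↦ A⁻¹(y - b), whose Jacobian is |det A|⁻¹. The orbit map of a
density is thereby an explicit smooth family of densities. -/
lemma affAct_densityQV {f : V → ℂ} (hf : ContDiff ℝ ∞ f) (g : V ≃ᵃ[ℝ] V) :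
    (densityQV μ fun y => affPushforward f (affCoord g, y)) = affAct g (densityQV μ f) := by
  let e : V ≃L[ℝ] V := g.linear.toContinuousLinearEquiv
  have he : (affCoord g).1 = (e : V →L[ℝ] V) := rfl
  have hunit : affCoord g ∈ {p : (V →L[ℝ] V) × V | IsUnit p.1} :=
    ⟨ContinuousLinearEquiv.toUnit e, rfl⟩
  have hinv : Ring.inverse (affCoord g).1 = (e.symm : V →L[ℝ] V) := by
    rw [he, ContinuousLinearMap.ringInverse_equiv, ContinuousLinearMap.inverse_equiv]
  have hgi : ∀ y, g⁻¹ y = e.symm (y - g 0) := by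
    intro y
    apply g.injective
    have h1 : g (g⁻¹ y) = y := g.apply_symm_apply y
    have h2 : g.linear (e.symm (y - g 0)) = y - g 0 := e.apply_symm_apply _
    rw [h1, apply_eq_linear_add g, h2, sub_add_cancel]
  apply incl_injective
  rw [incl_densityQV μ (contDiff_slice (contDiffOn_affPushforward hf) hunit)]
  funext K
  change evalDensity μ _ K = QV.incl V (densityQV μ f) (affImage g⁻¹ K)
  rw [incl_densityQV μ hf]
  change _ = ∫ x in ⇑(g⁻¹ : V ≃ᵃ[ℝ] V) '' (K : Set V), f x ∂μ
  have hfun : (⇑(g⁻¹ : V ≃ᵃ[ℝ] V) : V → V) = fun y => e.symm (y - g 0) := funext hgi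
  rw [hfun, integral_image_eq_integral_abs_det_fderiv_smul μ K.isClosed.measurableSet
    (f' := fun _ => (e.symm : V →L[ℝ] V))]
  · refine setIntegral_congr_fun K.isClosed.measurableSet fun y _ => ?_
    have hdet : |(e : V →L[ℝ] V).det|⁻¹ = |(e.symm : V →L[ℝ] V).det| := by
      rw [← abs_inv, ContinuousLinearEquiv.det_coe_symm]
    simp only [affPushforward]
    rw [hinv, he, hdet]
    rfl
  · intro y _
    have := e.symm.hasFDerivAt.comp y ((hasFDerivAt_id y).sub_const (g 0))
    exact this.hasFDerivWithinAt
  · intro y _ z _ hyz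
    simpa using hyz

lemma densityQV_mem_SV {f : V → ℂ} (hf : ContDiff ℝ ∞ f) : densityQV μ f ∈ SV V :=
  ⟨fun p => densityQV μ fun y => affPushforward f (p, y),
    fun k => isCkOn_densityQV μ isOpen_affChart k (contDiffOn_affPushforward hf),
    affAct_densityQV μ hf⟩

/-! ### Derivatives at the vertex of the cone of homothets -/

/-- The curve `t ↦ φ(tK + x)`. -/
def homothets (φ : ConvexBody V → ℂ) (K : ConvexBody V) (x : V) (t : ℝ) : ℂ :=
  φ (t • K + point x)

lemma homothets_eq_comp (φ : ConvexBody V → ℂ) (K : ConvexBody V) (x : V) :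
    homothets φ K x = scaleTranslate φ K ∘ fun t => (t, x) := rfl

/-- In the Leibniz expansion at 0 only the term with exactly n derivatives on t ^ n survives, and
for k ≤ n it occurs only when k = n. -/
lemma iteratedDerivWithin_pow_smul (n k : ℕ) (hk : k ≤ n) {g : ℝ → ℂ} (hg : ContDiff ℝ ∞ g) :
    iteratedDerivWithin k (fun t : ℝ => t ^ n • g t) (Icc 0 1) 0 =
      if k = n then (n.factorial : ℝ) • g 0 else 0 := by
  have h0 : (0 : ℝ) ∈ Icc (0 : ℝ) 1 := by simp
  have h := iteratedDerivWithin_smul (n := k) h0 uniqueDiffOn_Icc_zero_one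
    (f := fun t : ℝ => t ^ n) (g := g) (contDiff_id.pow n).contDiffWithinAt
    (hg.of_le (by exact_mod_cast le_top)).contDiffWithinAt
  refine h.trans ?_
  have hterm : ∀ i ∈ Finset.range (k + 1), k.choose i •
      iteratedDerivWithin i (fun t : ℝ => t ^ n) (Icc 0 1) 0 •
        iteratedDerivWithin (k - i) g (Icc 0 1) 0 =
      if i = n then (n.factorial : ℝ) • g 0 else 0 := by
    intro i hi
    have hi : i ≤ k := Nat.lt_succ_iff.1 (Finset.mem_range.1 hi)
    rw [iteratedDerivWithin_pow h0 uniqueDiffOn_Icc_zero_one]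
    split_ifs with hin
    · have : k = n := le_antisymm hk (hin ▸ hi)
      subst hin; subst this
      simp [Nat.descFactorial_self]
    · rw [zero_pow (by omega)]
      simp
  rw [Finset.sum_congr rfl hterm, Finset.sum_ite_eq' (Finset.range (k + 1)) n]
  simp only [Finset.mem_range]
  congr 1
  simp only [eq_iff_iff]
  omega

/-- On [0,1] the curve is t ^ n times a smooth function whose value at 0 is μ(K) f(x). The case k =
n dictates the candidate density in `exists_evalDensity_eq`. -/
lemma iteratedDerivWithin_homothets_evalDensity {f : V → ℂ} (hf : ContDiff ℝ ∞ f)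
    (K : ConvexBody V) (x : V) {k : ℕ} (hk : k ≤ Module.finrank ℝ V) :
    iteratedDerivWithin k (homothets (evalDensity μ f) K x) (Icc 0 1) 0 =
      if k = Module.finrank ℝ V then
        ((Module.finrank ℝ V).factorial * μ.real (K : Set V)) • f x else 0 := by
  have h0 : (0 : ℝ) ∈ Icc (0 : ℝ) 1 := by simp
  have hg : ContDiff ℝ ∞ fun t : ℝ => ∫ y in (K : Set V), f (t • y + x) ∂μ :=
    contDiff_setIntegral K.isCompact (M := fun z : ℝ × V => f (z.1 • z.2 + x)) (by fun_prop)
  have hcongr : EqOn (homothets (evalDensity μ f) K x)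
      (fun t => t ^ Module.finrank ℝ V • ∫ y in (K : Set V), f (t • y + x) ∂μ) (Icc 0 1) := by
    intro t ht
    rw [homothets_eq_comp, Function.comp, scaleTranslate_evalDensity μ f K ⟨ht, mem_univ _⟩,
      integral_smul]
  rw [iteratedDerivWithin_congr hcongr h0, iteratedDerivWithin_pow_smul _ _ hk hg]
  simp [mul_smul]

lemma evalDensity_mem_W {f : V → ℂ} (hf : ContDiff ℝ ∞ f) :
    evalDensity μ f ∈ W V (Module.finrank ℝ V) := by
  refine ⟨⟨densityQV μ f, densityQV_mem_SV μ hf, incl_densityQV μ hf⟩, fun k hk K x => ?_⟩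
  have := iteratedDerivWithin_homothets_evalDensity μ hf K x hk.le
  rwa [if_neg hk.ne] at this

/-- A continuous density is determined by its integrals over small balls. -/
lemma evalDensity_injOn : InjOn (evalDensity μ) (smoothDensities V) := by
  intro f hf g hg hfg
  have hf : ContDiff ℝ ∞ f := hf
  have hg : ContDiff ℝ ∞ g := hg
  have hh : Continuous (f - g) := hf.continuous.sub hg.continuous
  have hz : ∀ K : ConvexBody V, ∫ x in (K : Set V), (f - g) x ∂μ = 0 := by
    intro K
    have h := congrFun (evalDensity_sub μ hf.continuous hg.continuous) K
    rw [hfg, sub_self] at h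
    exact h
  rw [← sub_eq_zero]
  funext x
  by_contra hne
  have hpos : 0 < ‖(f - g) x‖ := norm_pos_iff.2 hne
  obtain ⟨r, hr, hball⟩ := Metric.continuousAt_iff.1 hh.continuousAt _ hpos
  let K : ConvexBody V := ⟨Metric.closedBall x (r / 2), convex_closedBall _ _,
    isCompact_closedBall _ _, Metric.nonempty_closedBall.2 (by positivity)⟩
  have hKpos : 0 < μ.real (K : Set V) :=
    ENNReal.toReal_pos (Metric.measure_closedBall_pos μ x (by positivity)).ne'
      K.isCompact.measure_lt_top.ne
  have hint : IntegrableOn (f - g) K μ := hh.continuousOn.integrableOn_compact K.isCompact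
  have h1 : ∫ y in (K : Set V), ((f - g) y - (f - g) x) ∂μ =
      -(μ.real (K : Set V) • (f - g) x) := by
    rw [integral_sub hint (integrableOn_const K.isCompact.measure_lt_top.ne (by simp)), hz K]
    simp
  -- The oscillation of f - g on the ball attains its maximum, so it stays strictly below the norm
  -- at x, whereas the vanishing integral forces it to be at least that norm.
  obtain ⟨y, hyK, hy⟩ := K.isCompact.exists_isMaxOn K.nonempty
    (f := fun y => ‖(f - g) y - (f - g) x‖) (hh.sub continuous_const).norm.continuousOn
  have h2 : ‖∫ y in (K : Set V), ((f - g) y - (f - g) x) ∂μ‖ ≤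
      ‖(f - g) y - (f - g) x‖ * μ.real (K : Set V) :=
    norm_setIntegral_le_of_norm_le_const K.isCompact.measure_lt_top fun z hz => hy hz
  have h3 : ‖(f - g) y - (f - g) x‖ < ‖(f - g) x‖ := by
    rw [← dist_eq_norm]
    exact hball ((Metric.mem_closedBall.1 hyK).trans_lt (half_lt_self hr))
  rw [h1, norm_neg, norm_smul, Real.norm_of_nonneg hKpos.le, mul_comm] at h2
  exact (le_of_mul_le_mul_right h2 hKpos).not_gt h3

end AffineAction

/-! ### Decomposition into small cubes -/

section Cells

open scoped ENNReal Pointwise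

/-- Iterated cuts along level sets of the functions `u i`. -/
lemma le_sum_cells {α : Type*} {A : Set α → ℝ≥0∞} {κ : ℝ≥0∞} (hA : A ∅ = 0) {n : ℕ}
    {u : Fin n → α → ℝ}
    (hcut : ∀ S i c, A S ≤ A (S ∩ {x | u i x ≤ c}) + κ * A (S ∩ {x | c ≤ u i x}))
    {a h : ℝ} (hh : 0 ≤ h) (m : ℕ) {S : Set α}
    (hS : ∀ x ∈ S, ∀ i, a < u i x ∧ u i x ≤ a + m * h) :
    A S ≤ κ ^ n * ∑ k : Fin n → Fin m,
      A (S ∩ {x | ∀ i, u i x ∈ Icc (a + (k i : ℕ) * h) (a + ((k i : ℕ) + 1) * h)}) := by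
  induction n generalizing S with
  | zero => simp
  | succ n ih =>
    -- Slabs are peeled off from the top. The remaining lower part carries the coefficient 1, so κ
    -- enters once per coordinate and the total factor κ ^ n does not depend on m.
    have h1 : ∀ l : ℕ, A (S ∩ {x | u 0 x ≤ a + l * h}) ≤ κ * ∑ j ∈ Finset.range l,
        A (S ∩ {x | u 0 x ∈ Icc (a + (j : ℕ) * h) (a + ((j : ℕ) + 1) * h)}) := by
      intro l
      induction l with
      | zero =>
        -- This is where the lower bound in `hS` must be strict.
        have : S ∩ {x | u 0 x ≤ a + (0 : ℕ) * h} = ∅ := by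
          ext x
          simp only [mem_inter_iff, mem_ofPred_eq, mem_empty_iff_false, iff_false, not_and, not_le]
          intro hx
          simpa using (hS x hx 0).1
        rw [this, hA]
        exact zero_le
      | succ l ihl =>
        refine (hcut _ 0 (a + l * h)).trans ?_
        rw [Finset.sum_range_succ, mul_add]
        refine add_le_add (le_trans (le_of_eq ?_) ihl) (le_of_eq ?_)
        · congr 1
          ext x
          simp only [mem_inter_iff, mem_ofPred_eq, Nat.cast_add, Nat.cast_one]
          constructor
          · rintro ⟨⟨h1, -⟩, h2⟩
            exact ⟨h1, h2⟩
          · rintro ⟨h1, h2⟩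
            exact ⟨⟨h1, by linarith⟩, h2⟩
        · congr 2
          ext x
          simp only [mem_inter_iff, mem_ofPred_eq, Nat.cast_add, Nat.cast_one, mem_Icc]
          tauto
    have h2 : S ∩ {x | u 0 x ≤ a + m * h} = S :=
      inter_eq_left.2 fun x hx => (hS x hx 0).2
    have h3 := h1 m
    rw [h2, Finset.sum_range (fun j : ℕ =>
      A (S ∩ {x | u 0 x ∈ Icc (a + (j : ℕ) * h) (a + ((j : ℕ) + 1) * h)}))] at h3
    refine h3.trans ?_
    have h4 : ∀ j : Fin m, A (S ∩ {x | u 0 x ∈ Icc (a + (j : ℕ) * h) (a + ((j : ℕ) + 1) * h)}) ≤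
        κ ^ n * ∑ k : Fin n → Fin m,
          A (S ∩ {x | ∀ i, u i x ∈ Icc (a + ((Fin.cons j k : Fin (n + 1) → Fin m) i : ℕ) * h)
            (a + (((Fin.cons j k : Fin (n + 1) → Fin m) i : ℕ) + 1) * h)}) := by
      intro j
      refine (ih (u := fun i => u i.succ) (fun S i c => hcut S i.succ c)
        fun x hx i => hS x hx.1 i.succ).trans (le_of_eq ?_)
      congr 1
      refine Finset.sum_congr rfl fun k _ => ?_
      congr 1
      ext x
      simp only [mem_inter_iff, mem_ofPred_eq, Fin.forall_fin_succ, Fin.cons_zero, Fin.cons_succ,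
        and_assoc]
    refine (mul_le_mul_right (Finset.sum_le_sum fun j _ => h4 j) κ).trans (le_of_eq ?_)
    rw [← Finset.mul_sum, ← mul_assoc, ← pow_succ', ← Fintype.sum_prod_type',
      ← (Fin.consEquiv fun _ : Fin (n + 1) => Fin m).sum_comp]
    rfl

variable {V : Type*} [NormedAddCommGroup V] [NormedSpace ℝ V]
  {n : ℕ} (b : Module.Basis (Fin n) ℝ V)

/-- The point all of whose coordinates are `a + k i * h`. -/
def corner (a h : ℝ) {m : ℕ} (k : Fin n → Fin m) : V :=
  b.equivFun.symm fun i => a + (k i : ℕ) * h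

/-- The cell of side `h` with the given corner. -/
def cell (a h : ℝ) {m : ℕ} (k : Fin n → Fin m) : Set V :=
  {x | ∀ i, b.equivFun x i ∈ Icc (a + (k i : ℕ) * h) (a + ((k i : ℕ) + 1) * h)}

/-- The half-open cell of side `h` with the given corner. -/
def halfOpenCell (a h : ℝ) {m : ℕ} (k : Fin n → Fin m) : Set V :=
  {x | ∀ i, b.equivFun x i ∈ Ico (a + (k i : ℕ) * h) (a + ((k i : ℕ) + 1) * h)}

/-- The unit half-open cube. -/
def halfOpenCube : Set V := {x | ∀ i, b.equivFun x i ∈ Ico (0 : ℝ) 1}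

variable [FiniteDimensional ℝ V]

lemma continuous_equivFun : Continuous b.equivFun := b.equivFunL.continuous

/-- The unit cube of a basis. -/
def unitCube : ConvexBody V where
  carrier := {x | ∀ i, b.equivFun x i ∈ Icc (0 : ℝ) 1}
  convex' := by
    have : {x : V | ∀ i, b.equivFun x i ∈ Icc (0 : ℝ) 1} =
        b.equivFun.toLinearMap ⁻¹' Set.pi univ fun _ => Icc (0 : ℝ) 1 := by
      ext
      simp only [mem_preimage, Set.mem_pi, mem_univ, true_imp_iff]
      rfl
    rw [this]
    exact (convex_pi fun _ _ => convex_Icc _ _).linear_preimage _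
  isCompact' := by
    have : {x : V | ∀ i, b.equivFun x i ∈ Icc (0 : ℝ) 1} =
        b.equivFunL.symm '' Set.pi univ fun _ => Icc (0 : ℝ) 1 := by
      rw [ContinuousLinearEquiv.image_symm_eq_preimage]
      ext
      simp only [mem_preimage, Set.mem_pi, mem_univ, true_imp_iff]
      rfl
    rw [this]
    exact (isCompact_univ_pi fun _ => isCompact_Icc).image b.equivFunL.symm.continuous
  nonempty' := ⟨0, fun i => by simp⟩

lemma mem_unitCube {x : V} : x ∈ (unitCube b : Set V) ↔ ∀ i, b.equivFun x i ∈ Icc (0 : ℝ) 1 :=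
  Iff.rfl

lemma smul_add_corner_mem_cell {a h : ℝ} (hh : 0 < h) {m : ℕ} (k : Fin n → Fin m) {y : V} :
    h • y + corner b a h k ∈ cell b a h k ↔ y ∈ (unitCube b : Set V) := by
  simp only [cell, mem_ofPred_eq, mem_unitCube, corner, map_add, map_smul,
    LinearEquiv.apply_symm_apply, Pi.add_apply, Pi.smul_apply, smul_eq_mul, mem_Icc]
  refine forall_congr' fun i => ?_
  constructor
  · rintro ⟨h1, h2⟩
    exact ⟨by nlinarith, by nlinarith⟩
  · rintro ⟨h1, h2⟩
    exact ⟨by nlinarith, by nlinarith⟩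

lemma smul_add_corner_mem_halfOpenCell {a h : ℝ} (hh : 0 < h) {m : ℕ} (k : Fin n → Fin m) {y : V} :
    h • y + corner b a h k ∈ halfOpenCell b a h k ↔ y ∈ halfOpenCube b := by
  simp only [halfOpenCell, mem_ofPred_eq, halfOpenCube, corner, map_add, map_smul,
    LinearEquiv.apply_symm_apply, Pi.add_apply, Pi.smul_apply, smul_eq_mul, mem_Ico]
  refine forall_congr' fun i => ?_
  constructor
  · rintro ⟨h1, h2⟩
    exact ⟨by nlinarith, by nlinarith⟩
  · rintro ⟨h1, h2⟩
    exact ⟨by nlinarith, by nlinarith⟩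

lemma exists_smul_add {h : ℝ} (hh : 0 < h) (c x : V) : ∃ y, h • y + c = x :=
  ⟨h⁻¹ • (x - c), by rw [smul_inv_smul₀ hh.ne', sub_add_cancel]⟩

lemma cell_eq_image {a h : ℝ} (hh : 0 < h) {m : ℕ} (k : Fin n → Fin m) :
    cell b a h k = (fun y => h • y + corner b a h k) '' (unitCube b : Set V) := by
  ext x
  obtain ⟨y, rfl⟩ := exists_smul_add hh (corner b a h k) x
  rw [smul_add_corner_mem_cell b hh]
  constructor
  · intro hy
    exact ⟨y, hy, rfl⟩
  · rintro ⟨z, hz, hzy⟩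
    have : z = y := by simpa [hh.ne'] using hzy
    rwa [← this]

lemma halfOpenCell_eq_image {a h : ℝ} (hh : 0 < h) {m : ℕ} (k : Fin n → Fin m) :
    halfOpenCell b a h k = (fun y => h • y + corner b a h k) '' halfOpenCube b := by
  ext x
  obtain ⟨y, rfl⟩ := exists_smul_add hh (corner b a h k) x
  rw [smul_add_corner_mem_halfOpenCell b hh]
  constructor
  · intro hy
    exact ⟨y, hy, rfl⟩
  · rintro ⟨z, hz, hzy⟩
    have : z = y := by simpa [hh.ne'] using hzy
    rwa [← this]

lemma halfOpenCell_subset_cell {a h : ℝ} {m : ℕ} (k : Fin n → Fin m) :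
    halfOpenCell b a h k ⊆ cell b a h k := fun _ hx i => Ico_subset_Icc_self (hx i)

lemma cell_eq_coe {a h : ℝ} (hh : 0 < h) {m : ℕ} (k : Fin n → Fin m) :
    cell b a h k = ((h • unitCube b + point (corner b a h k) : ConvexBody V) : Set V) := by
  change _ = h • (unitCube b : Set V) + {corner b a h k}
  rw [add_singleton, ← image_smul, image_image, cell_eq_image b hh]

lemma corner_mem_cell {a h : ℝ} (hh : 0 < h) {m : ℕ} (k : Fin n → Fin m) :
    corner b a h k ∈ cell b a h k := by
  have := (smul_add_corner_mem_cell b (a := a) hh k (y := 0)).2 fun i => by simp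
  simpa using this

lemma dist_le_of_mem_cell {a h : ℝ} (hh : 0 < h) {m : ℕ} {k : Fin n → Fin m} {x y : V}
    (hx : x ∈ cell b a h k) (hy : y ∈ cell b a h k) :
    dist x y ≤ h * Metric.diam (unitCube b : Set V) := by
  rw [cell_eq_image b hh] at hx hy
  obtain ⟨x, hx, rfl⟩ := hx
  obtain ⟨y, hy, rfl⟩ := hy
  simp only [dist_add_right, dist_smul₀, Real.norm_of_nonneg hh.le]
  gcongr
  exact Metric.dist_le_diam_of_mem (unitCube b).isBounded hx hy

/-- Together with `card_mul_le_measure`, this bounds the number of cells meeting T by the measure of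
a neighbourhood of T whose width is proportional to h. -/
lemma cell_subset_cthickening {a h : ℝ} (hh : 0 < h) {m : ℕ} {k : Fin n → Fin m} {T : Set V}
    (hT : (cell b a h k ∩ T).Nonempty) :
    cell b a h k ⊆ Metric.cthickening (h * Metric.diam (unitCube b : Set V)) T := by
  obtain ⟨y, hy, hyT⟩ := hT
  exact fun x hx => Metric.mem_cthickening_of_dist_le x y _ _ hyT (dist_le_of_mem_cell b hh hx hy)

lemma disjoint_halfOpenCell {a h : ℝ} (hh : 0 < h) {m : ℕ} {k l : Fin n → Fin m} (hkl : k ≠ l) :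
    Disjoint (halfOpenCell b a h k) (halfOpenCell b a h l) := by
  rw [Set.disjoint_left]
  intro x hx hx'
  apply hkl
  funext i
  obtain ⟨h1, h2⟩ := hx i
  obtain ⟨h3, h4⟩ := hx' i
  have h5 : ((k i : ℕ) : ℝ) < (l i : ℕ) + 1 := by
    by_contra hlt
    rw [not_lt] at hlt
    nlinarith
  have h6 : ((l i : ℕ) : ℝ) < (k i : ℕ) + 1 := by
    by_contra hlt
    rw [not_lt] at hlt
    nlinarith
  have h5 : (k i : ℕ) < (l i : ℕ) + 1 := by exact_mod_cast h5
  have h6 : (l i : ℕ) < (k i : ℕ) + 1 := by exact_mod_cast h6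
  ext
  omega

/-! ### Measure and number of grid cells -/

variable [MeasurableSpace V] [BorelSpace V] (μ : Measure V) [μ.IsAddHaarMeasure]

lemma measurableSet_halfOpenCell (a h : ℝ) {m : ℕ} (k : Fin n → Fin m) :
    MeasurableSet (halfOpenCell b a h k) := by
  have : halfOpenCell b a h k =
      ⋂ i, (fun x => b.equivFun x i) ⁻¹' Ico (a + (k i : ℕ) * h) (a + ((k i : ℕ) + 1) * h) := by
    ext; simp [halfOpenCell]
  rw [this]
  refine MeasurableSet.iInter fun i => ?_
  exact ((continuous_apply i).comp (continuous_equivFun b)).measurable measurableSet_Ico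

lemma measure_halfOpenCell (hn : n = Module.finrank ℝ V) {a h : ℝ} (hh : 0 < h) {m : ℕ}
    (k : Fin n → Fin m) :
    μ (halfOpenCell b a h k) = ENNReal.ofReal (h ^ n) * μ (halfOpenCube b) := by
  have : halfOpenCell b a h k = (fun x => x + -corner b a h k) ⁻¹' (h • halfOpenCube b) := by
    rw [halfOpenCell_eq_image b hh, ← image_smul]
    ext x
    simp only [mem_image, mem_preimage]
    refine exists_congr fun y => and_congr_right fun _ => ?_
    rw [← sub_eq_add_neg, eq_sub_iff_add_eq]
  rw [this, measure_preimage_add_right, Measure.addHaar_smul, ← hn, abs_of_pos (pow_pos hh n)]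

lemma measure_halfOpenCube_ne_zero : μ (halfOpenCube b) ≠ 0 := by
  have hopen : IsOpen {x : V | ∀ i, b.equivFun x i ∈ Ioo (0 : ℝ) 1} := by
    have : {x : V | ∀ i, b.equivFun x i ∈ Ioo (0 : ℝ) 1} =
        ⋂ i, (fun x => b.equivFun x i) ⁻¹' Ioo (0 : ℝ) 1 := by
      ext; simp
    rw [this]
    exact isOpen_iInter_of_finite fun i =>
      isOpen_Ioo.preimage ((continuous_apply i).comp (continuous_equivFun b))
  have hne : {x : V | ∀ i, b.equivFun x i ∈ Ioo (0 : ℝ) 1}.Nonempty := by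
    refine ⟨b.equivFun.symm fun _ => 1 / 2, fun i => ?_⟩
    rw [LinearEquiv.apply_symm_apply]
    norm_num
  have hsub : {x : V | ∀ i, b.equivFun x i ∈ Ioo (0 : ℝ) 1} ⊆ halfOpenCube b :=
    fun x hx i => Ioo_subset_Ico_self (hx i)
  exact ((hopen.measure_pos μ hne).trans_le (measure_mono hsub)).ne'

/-- A bound for the number of cells contained in a set. -/
lemma card_mul_le_measure (hn : n = Module.finrank ℝ V) {a h : ℝ} (hh : 0 < h) {m : ℕ}
    (F : Finset (Fin n → Fin m)) {T : Set V} (hF : ∀ k ∈ F, cell b a h k ⊆ T) :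
    F.card * ENNReal.ofReal (h ^ n) * μ (halfOpenCube b) ≤ μ T := by
  -- Closed cells overlap along faces; the half-open ones inside them are disjoint and have equal
  -- measure.
  have h1 := measure_biUnion_finset (μ := μ) (s := F) (f := halfOpenCell b a h)
    (fun k _ l _ hkl => disjoint_halfOpenCell b hh hkl)
    fun k _ => measurableSet_halfOpenCell b a h k
  simp only [measure_halfOpenCell b μ hn hh, Finset.sum_const, nsmul_eq_mul] at h1
  rw [mul_assoc, ← h1]
  exact measure_mono (iUnion₂_subset fun k hk => (halfOpenCell_subset_cell b k).trans (hF k hk))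

/-- A convex body is covered by arbitrarily fine finite arrays of cells. -/
lemma frequently_le_sum_cells {A : Set V → ℝ≥0∞} {κ : ℝ≥0∞} (hA : A ∅ = 0)
    (hcut : ∀ S i c, A S ≤
      A (S ∩ {x | b.equivFun x i ≤ c}) + κ * A (S ∩ {x | c ≤ b.equivFun x i}))
    (K : ConvexBody V) :
    ∃ᶠ h in 𝓝[>] (0 : ℝ), ∃ (a : ℝ) (m : ℕ),
      A K ≤ κ ^ n * ∑ k : Fin n → Fin m, A (K ∩ cell b a h k) := by
  obtain ⟨M, hM⟩ := K.isCompact.exists_bound_of_continuousOn (continuous_equivFun b).continuousOn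
  -- The extra 1 makes the lower coordinate bound strict, as `le_sum_cells` demands.
  let M' := |M| + 1
  have hM' : 0 < M' := by positivity
  -- The admissible sides are 2M' / (N + 1), which divide the bounding cube exactly; hence a
  -- statement about frequently occurring, not all, small h.
  have hlim : Tendsto (fun N : ℕ => 2 * M' * (1 / ((N : ℝ) + 1))) atTop (𝓝[>] 0) := by
    refine tendsto_nhdsWithin_iff.2 ⟨?_, .of_forall fun N => ?_⟩
    · simpa using tendsto_one_div_add_atTop_nhds_zero_nat.const_mul (2 * M')
    · exact (by positivity : (0 : ℝ) < 2 * M' * (1 / ((N : ℝ) + 1)))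
  refine hlim.frequently (Filter.Eventually.frequently (.of_forall fun N => ?_))
  refine ⟨-M', N + 1, le_sum_cells hA hcut (by positivity) (N + 1) fun x hx i => ?_⟩
  have h1 : |b.equivFun x i| < M' :=
    ((norm_le_pi_norm (b.equivFun x) i).trans (hM x hx)).trans_lt
      ((le_abs_self M).trans_lt (lt_add_one _))
  have h2 : -M' + ((N + 1 : ℕ) : ℝ) * (2 * M' * (1 / ((N : ℝ) + 1))) = M' := by
    push_cast
    field_simp
    ring
  rw [h2]
  exact ⟨(abs_lt.1 h1).1, (abs_lt.1 h1).2.le⟩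

end Cells

/-! ### Valuations of small growth vanish -/

section Vanishing

open scoped ENNReal Pointwise

variable {V : Type*} [NormedAddCommGroup V] [NormedSpace ℝ V]

/-- The convex body with a given underlying set. -/
def bodyOf (S : Set V) (hc : Convex ℝ S) (hS : IsCompact S) (hne : S.Nonempty) : ConvexBody V :=
  ⟨S, hc, hS, hne⟩

open Classical in
/-- The extension of a function of convex bodies by zero to all sets. -/
def extendZero (ψ : ConvexBody V → ℂ) (S : Set V) : ℂ :=
  if h : Convex ℝ S ∧ IsCompact S ∧ S.Nonempty then ψ (bodyOf S h.1 h.2.1 h.2.2) else 0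

lemma extendZero_coe (ψ : ConvexBody V → ℂ) (K : ConvexBody V) : extendZero ψ (K : Set V) = ψ K := by
  rw [extendZero, dif_pos ⟨K.convex, K.isCompact, K.nonempty⟩]
  rfl

lemma extendZero_empty (ψ : ConvexBody V → ℂ) : extendZero ψ ∅ = 0 := by
  rw [extendZero, dif_neg (by simp)]

variable [FiniteDimensional ℝ V]

/-- If both halves are nonempty, connectedness makes the section nonempty and the valuation property
applies. Otherwise one half is S and the other two sets are empty. Extension by zero thus removes
all nonemptiness conditions from repeated cutting. -/
lemma extendZero_cut {ψ : ConvexBody V → ℂ} (hψ : IsValuation ψ) {S : Set V} (hc : Convex ℝ S)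
    (hS : IsCompact S) (u : V →ₗ[ℝ] ℝ) (c : ℝ) :
    extendZero ψ S = extendZero ψ (S ∩ {x | u x ≤ c}) + extendZero ψ (S ∩ {x | c ≤ u x}) -
      extendZero ψ (S ∩ {x | u x = c}) := by
  have hu : Continuous u := u.continuous_of_finiteDimensional
  by_cases h1 : (S ∩ {x | u x ≤ c}).Nonempty
  · by_cases h2 : (S ∩ {x | c ≤ u x}).Nonempty
    · have h3 : (S ∩ {x | u x = c}).Nonempty := by
        obtain ⟨x, hxS, hx⟩ := h1
        obtain ⟨y, hyS, hy⟩ := h2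
        obtain ⟨z, hz, hzc⟩ := hc.isPreconnected.intermediate_value hxS hyS hu.continuousOn ⟨hx, hy⟩
        exact ⟨z, hz, hzc⟩
      have c1 : Convex ℝ (S ∩ {x | u x ≤ c}) := hc.inter (convex_halfSpace_le u.isLinear c)
      have c2 : Convex ℝ (S ∩ {x | c ≤ u x}) := hc.inter (convex_halfSpace_ge u.isLinear c)
      have c3 : Convex ℝ (S ∩ {x | u x = c}) := hc.inter (convex_hyperplane u.isLinear c)
      have k1 : IsCompact (S ∩ {x | u x ≤ c}) :=
        hS.inter_right (isClosed_le hu continuous_const)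
      have k2 : IsCompact (S ∩ {x | c ≤ u x}) :=
        hS.inter_right (isClosed_le continuous_const hu)
      have k3 : IsCompact (S ∩ {x | u x = c}) :=
        hS.inter_right (isClosed_eq hu continuous_const)
      have hne : S.Nonempty := h1.mono inter_subset_left
      have := hψ (bodyOf _ c1 k1 h1) (bodyOf _ c2 k2 h2) (bodyOf _ hc hS hne) (bodyOf _ c3 k3 h3)
        (by
          change S = (S ∩ {x | u x ≤ c}) ∪ (S ∩ {x | c ≤ u x})
          rw [← inter_union_distrib_left]
          refine (inter_eq_left.2 fun x _ => ?_).symm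
          exact le_total (u x) c)
        (by
          change S ∩ {x | u x = c} = (S ∩ {x | u x ≤ c}) ∩ (S ∩ {x | c ≤ u x})
          rw [← inter_inter_distrib_left]
          congr 1
          ext x
          exact le_antisymm_iff)
      rw [extendZero, dif_pos ⟨hc, hS, hne⟩, extendZero, dif_pos ⟨c1, k1, h1⟩, extendZero,
        dif_pos ⟨c2, k2, h2⟩, extendZero, dif_pos ⟨c3, k3, h3⟩, this]
    · rw [not_nonempty_iff_eq_empty] at h2
      have h3 : S ∩ {x | u x = c} = ∅ := by
        rw [← subset_empty_iff, ← h2]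
        exact fun x hx => ⟨hx.1, hx.2.ge⟩
      have h4 : S ∩ {x | u x ≤ c} = S := by
        refine inter_eq_left.2 fun x hx => ?_
        by_contra hlt
        have : x ∈ S ∩ {x | c ≤ u x} := ⟨hx, (le_total (u x) c).resolve_left hlt⟩
        rw [h2] at this
        exact this
      rw [h2, h3, h4, extendZero_empty]
      ring
  · rw [not_nonempty_iff_eq_empty] at h1
    have h3 : S ∩ {x | u x = c} = ∅ := by
      rw [← subset_empty_iff, ← h1]
      exact fun x hx => ⟨hx.1, hx.2.le⟩
    have h4 : S ∩ {x | c ≤ u x} = S := by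
      refine inter_eq_left.2 fun x hx => ?_
      by_contra hlt
      have : x ∈ S ∩ {x | u x ≤ c} := ⟨hx, (le_total c (u x)).resolve_left hlt⟩
      rw [h1] at this
      exact this
    rw [h1, h3, h4, extendZero_empty]
    ring

/-- The supremum of `|ψ|` over the convex bodies contained in a set. -/
def maxVariation (ψ : ConvexBody V → ℂ) (S : Set V) : ℝ≥0∞ :=
  ⨆ (T : ConvexBody V) (_ : (T : Set V) ⊆ S), ‖ψ T‖ₑ

lemma enorm_le_maxVariation (ψ : ConvexBody V → ℂ) {S : Set V} {T : ConvexBody V}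
    (h : (T : Set V) ⊆ S) : ‖ψ T‖ₑ ≤ maxVariation ψ S :=
  le_iSup₂ (f := fun (T : ConvexBody V) (_ : (T : Set V) ⊆ S) => ‖ψ T‖ₑ) T h

lemma enorm_extendZero_le_maxVariation (ψ : ConvexBody V → ℂ) {S T : Set V} (h : T ⊆ S) :
    ‖extendZero ψ T‖ₑ ≤ maxVariation ψ S := by
  unfold extendZero
  split_ifs with hT
  · exact enorm_le_maxVariation ψ (T := bodyOf T hT.1 hT.2.1 hT.2.2) h
  · simp

lemma maxVariation_empty (ψ : ConvexBody V → ℂ) : maxVariation ψ ∅ = 0 := by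
  refine nonpos_iff_eq_zero.1 (iSup₂_le fun T hT => ?_)
  exact absurd (subset_empty_iff.1 hT) T.nonempty.ne_empty

/-- The section of a sub-body is itself a body in the upper part, so it is absorbed by the supremum
there; this accounts for the factor 2. -/
lemma maxVariation_cut {ψ : ConvexBody V → ℂ} (hψ : IsValuation ψ) (S : Set V) (u : V →ₗ[ℝ] ℝ)
    (c : ℝ) : maxVariation ψ S ≤
      maxVariation ψ (S ∩ {x | u x ≤ c}) + 2 * maxVariation ψ (S ∩ {x | c ≤ u x}) := by
  refine iSup₂_le fun T hT => ?_
  rw [← extendZero_coe ψ T, extendZero_cut hψ T.convex T.isCompact u c, two_mul, ← add_assoc]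
  refine enorm_sub_le.trans (add_le_add ((enorm_add_le _ _).trans (add_le_add ?_ ?_)) ?_)
  · exact enorm_extendZero_le_maxVariation ψ (inter_subset_inter_left _ hT)
  · exact enorm_extendZero_le_maxVariation ψ (inter_subset_inter_left _ hT)
  · exact enorm_extendZero_le_maxVariation ψ
      (inter_subset_inter hT fun x (hx : u x = c) => hx.ge)

variable {n : ℕ} (b : Module.Basis (Fin n) ℝ V)

/-- A body in a cell is a small homothet of a body in the unit cube. -/
lemma exists_homothet {a h : ℝ} (hh : 0 < h) {m : ℕ} {k : Fin n → Fin m} {T : ConvexBody V}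
    (hT : (T : Set V) ⊆ cell b a h k) :
    ∃ L : ConvexBody V, (L : Set V) ⊆ unitCube b ∧ T = h • L + point (corner b a h k) := by
  let L : ConvexBody V := h⁻¹ • (T + point (-corner b a h k))
  have hTL : T = h • L + point (corner b a h k) := by
    apply ConvexBody.ext
    change (T : Set V) = h • (h⁻¹ • ((T : Set V) + {-corner b a h k})) + {corner b a h k}
    rw [smul_inv_smul₀ hh.ne', add_assoc, singleton_add_singleton, neg_add_cancel]
    simp
  refine ⟨L, fun y hy => ?_, hTL⟩
  rw [← smul_add_corner_mem_cell b (a := a) hh k]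
  apply hT
  rw [hTL]
  change _ ∈ h • (L : Set V) + {corner b a h k}
  exact add_mem_add (smul_mem_smul_set hy) (mem_singleton _)

variable [MeasurableSpace V] [BorelSpace V] (μ : Measure V) [μ.IsAddHaarMeasure]

/-- The compact set containing the corners of all cells of side at most one that meet `K`. -/
def cornerRegion (K : ConvexBody V) : Set V :=
  Metric.cthickening (Metric.diam (unitCube b : Set V)) (K : Set V) ∪ unitCube b

lemma isCompact_cornerRegion (K : ConvexBody V) : IsCompact (cornerRegion b K) :=
  K.isCompact.cthickening.union (unitCube b).isCompact

lemma corner_mem_cornerRegion {a h : ℝ} (hh : 0 < h) (hh1 : h ≤ 1) {m : ℕ} {k : Fin n → Fin m}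
    {K : ConvexBody V} (hk : ((K : Set V) ∩ cell b a h k).Nonempty) :
    corner b a h k ∈ cornerRegion b K := by
  rw [inter_comm] at hk
  refine Or.inl (Metric.cthickening_mono ?_ _
    (cell_subset_cthickening b hh hk (corner_mem_cell b hh k)))
  exact mul_le_of_le_one_left Metric.diam_nonneg hh1

lemma enorm_le_of_subset_cell {ψ : ConvexBody V → ℂ} {K T : ConvexBody V} {C : ℝ}
    (hC : ∀ L : ConvexBody V, (L : Set V) ⊆ cornerRegion b K → ∀ x ∈ cornerRegion b K,
      ∀ t ∈ Icc (0 : ℝ) 1, ‖ψ (t • L + point x)‖ ≤ C * t ^ n)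
    {a h : ℝ} (hh : 0 < h) (hh1 : h ≤ 1) {m : ℕ} {k : Fin n → Fin m}
    (hT : (T : Set V) ⊆ K ∩ cell b a h k) : ‖ψ T‖ₑ ≤ ENNReal.ofReal C * ENNReal.ofReal (h ^ n) := by
  obtain ⟨L, hL, rfl⟩ := exists_homothet b hh (hT.trans inter_subset_right)
  -- One compact set must contain both L and the corner, which is why `cornerRegion` includes the
  -- unit cube.
  have h1 := hC L (hL.trans subset_union_right) _
    (corner_mem_cornerRegion b hh hh1 (ConvexBody.nonempty _ |>.mono hT)) h ⟨hh.le, hh1⟩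
  rw [← ENNReal.ofReal_mul' (by positivity), ← ofReal_norm]
  exact ENNReal.ofReal_le_ofReal h1

lemma maxVariation_cell_le {ψ : ConvexBody V → ℂ} {K : ConvexBody V} {C : ℝ}
    (hC : ∀ L : ConvexBody V, (L : Set V) ⊆ cornerRegion b K → ∀ x ∈ cornerRegion b K,
      ∀ t ∈ Icc (0 : ℝ) 1, ‖ψ (t • L + point x)‖ ≤ C * t ^ n)
    {a h : ℝ} (hh : 0 < h) (hh1 : h ≤ 1) {m : ℕ} (k : Fin n → Fin m) :
    maxVariation ψ (K ∩ cell b a h k) ≤ ENNReal.ofReal C * ENNReal.ofReal (h ^ n) :=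
  iSup₂_le fun _ hT => enorm_le_of_subset_cell b hC hh hh1 hT

lemma tendsto_measure_cthickening_mul {T : Set V} (hT : IsCompact T) (R : ℝ) :
    Tendsto (fun h : ℝ => μ (Metric.cthickening (h * R) T)) (𝓝[>] 0) (𝓝 (μ T)) := by
  have h1 : Tendsto (fun h : ℝ => h * R) (𝓝[>] 0) (𝓝 0) := by
    have : Continuous fun h : ℝ => h * R := by fun_prop
    simpa using (this.tendsto 0).mono_left nhdsWithin_le_nhds
  exact (tendsto_measure_cthickening_of_isCompact hT).comp h1

/-- A valuation all of whose values on small bodies are `O(t ^ n)` vanishes on bodies of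
measure zero. -/
lemma eq_zero_of_measure_eq_zero {ψ : ConvexBody V → ℂ}
    (hψ : IsValuation ψ)
    (hgrowth : ∀ G : Set V, IsCompact G → ∃ C : ℝ, ∀ L : ConvexBody V, (L : Set V) ⊆ G →
      ∀ x ∈ G, ∀ t ∈ Icc (0 : ℝ) 1, ‖ψ (t • L + point x)‖ ≤ C * t ^ Module.finrank ℝ V)
    {K : ConvexBody V} (hK : μ (K : Set V) = 0) : ψ K = 0 := by
  let b := Module.finBasis ℝ V
  let n := Module.finrank ℝ V
  obtain ⟨C, hC⟩ := hgrowth _ (isCompact_cornerRegion b K)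
  have hfreq := frequently_le_sum_cells b (A := maxVariation ψ) (κ := 2) (maxVariation_empty ψ)
    (fun S i c => maxVariation_cut hψ S (b.coord i) c) K
  have hsmall : ∀ᶠ h in 𝓝[>] (0 : ℝ), h ∈ Ioc (0 : ℝ) 1 := Ioc_mem_nhdsGT one_pos
  have hlim := ENNReal.Tendsto.const_mul
    (tendsto_measure_cthickening_mul μ K.isCompact (Metric.diam (unitCube b : Set V)))
    (a := 2 ^ n * ENNReal.ofReal C) (Or.inr (by finiteness))
  rw [hK, mul_zero] at hlim
  -- Each cell meeting K contributes at most C h^n, up to the factor 2 ^ n from the cuts. The number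
  -- of these cells times h^n μ(cube) is at most the measure of a shrinking neighbourhood of K,
  -- which tends to μ(K) = 0.
  have hle : maxVariation ψ K * μ (halfOpenCube b) ≤ 0 := by
    refine ge_of_tendsto_of_frequently hlim ((hfreq.and_eventually hsmall).mono ?_)
    rintro h ⟨⟨a, m, hsum⟩, hh, hh1⟩
    classical
    let F : Finset (Fin n → Fin m) :=
      Finset.univ.filter fun k => ((K : Set V) ∩ cell b a h k).Nonempty
    have hterm : ∀ k : Fin n → Fin m, maxVariation ψ (K ∩ cell b a h k) ≤
        if ((K : Set V) ∩ cell b a h k).Nonempty then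
          ENNReal.ofReal C * ENNReal.ofReal (h ^ n) else 0 := by
      intro k
      split_ifs with hk
      · exact maxVariation_cell_le b hC hh hh1 k
      · rw [not_nonempty_iff_eq_empty.1 hk, maxVariation_empty]
    have hcard := card_mul_le_measure b μ rfl hh F
      (T := Metric.cthickening (h * Metric.diam (unitCube b : Set V)) (K : Set V)) fun k hk =>
        cell_subset_cthickening b hh (by
          rw [inter_comm]; exact (Finset.mem_filter.1 hk).2)
    have hsum' := hsum.trans (mul_le_mul_right (Finset.sum_le_sum fun k _ => hterm k) _)
    rw [← Finset.sum_filter, Finset.sum_const, nsmul_eq_mul] at hsum'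
    calc maxVariation ψ K * μ (halfOpenCube b)
        ≤ 2 ^ n * (F.card * (ENNReal.ofReal C * ENNReal.ofReal (h ^ n))) * μ (halfOpenCube b) := by
          gcongr
      _ = 2 ^ n * ENNReal.ofReal C *
          (F.card * ENNReal.ofReal (h ^ n) * μ (halfOpenCube b)) := by ring
      _ ≤ _ := by gcongr
  have h0 : maxVariation ψ K = 0 :=
    (mul_eq_zero.1 (nonpos_iff_eq_zero.1 hle)).resolve_right (measure_halfOpenCube_ne_zero b μ)
  have := enorm_le_maxVariation ψ (subset_refl (K : Set V))
  rw [h0] at this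
  simpa using this

lemma measure_coordHyperplane (i : Fin n) (c : ℝ) : μ {x | b.coord i x = c} = 0 := by
  have h1 : {x | b.coord i x = c} =
      (AffineSubspace.mk' (c • b i) (LinearMap.ker (b.coord i)) : Set V) := by
    ext x
    simp [AffineSubspace.mem_mk', sub_eq_zero]
  rw [h1]
  refine Measure.addHaar_affineSubspace μ _ fun htop => ?_
  have h2 : (c + 1) • b i ∈ (AffineSubspace.mk' (c • b i) (LinearMap.ker (b.coord i))) := by
    rw [htop]; trivial
  simp [AffineSubspace.mem_mk'] at h2

/-- Null sections no longer contribute, so |ψ| itself satisfies the cutting inequality with κ = 1.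
Avoiding the supremum over sub-bodies is essential for the next theorem, whose o(t ^ n) bound
concerns cubes only. -/
lemma enorm_extendZero_cut {ψ : ConvexBody V → ℂ} (hψ : IsValuation ψ)
    (hnull : ∀ K : ConvexBody V, μ (K : Set V) = 0 → ψ K = 0) (S : Set V) (i : Fin n) (c : ℝ) :
    ‖extendZero ψ S‖ₑ ≤ ‖extendZero ψ (S ∩ {x | b.coord i x ≤ c})‖ₑ +
      1 * ‖extendZero ψ (S ∩ {x | c ≤ b.coord i x})‖ₑ := by
  by_cases hS : Convex ℝ S ∧ IsCompact S
  · have h0 : extendZero ψ (S ∩ {x | b.coord i x = c}) = 0 := by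
      unfold extendZero
      split_ifs with h
      · exact hnull _ (measure_mono_null inter_subset_right (measure_coordHyperplane b μ i c))
      · rfl
    rw [extendZero_cut hψ hS.1 hS.2 (b.coord i) c, h0, sub_zero, one_mul]
    exact enorm_add_le _ _
  · have h0 : extendZero ψ S = 0 := by
      rw [extendZero, dif_neg]
      exact fun h => hS ⟨h.1, h.2.1⟩
    rw [h0]
    simp

/-- A valuation with values `O(t ^ n)` on small bodies and `o(t ^ n)` on small cubes vanishes. -/
theorem eq_zero_of_small_growth (hn : n = Module.finrank ℝ V) {ψ : ConvexBody V → ℂ}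
    (hψ : IsValuation ψ)
    (hgrowth : ∀ G : Set V, IsCompact G → ∃ C : ℝ, ∀ L : ConvexBody V, (L : Set V) ⊆ G →
      ∀ x ∈ G, ∀ t ∈ Icc (0 : ℝ) 1, ‖ψ (t • L + point x)‖ ≤ C * t ^ n)
    (hcube : ∀ G : Set V, IsCompact G → ∀ ε > 0, ∃ δ > 0, ∀ t ∈ Ioo (0 : ℝ) δ, ∀ x ∈ G,
      ‖ψ (t • unitCube b + point x)‖ ≤ ε * t ^ n)
    (K : ConvexBody V) : ψ K = 0 := by
  subst hn
  let n := Module.finrank ℝ V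
  let μ : Measure V := Measure.addHaar
  obtain ⟨C, hC⟩ := hgrowth _ (isCompact_cornerRegion b K)
  have hfreq := frequently_le_sum_cells b (A := fun S => ‖extendZero ψ S‖ₑ) (κ := 1)
    (by simp [extendZero_empty])
    (fun S i c => enorm_extendZero_cut b μ hψ
      (fun K hK => eq_zero_of_measure_eq_zero μ hψ hgrowth hK) S i c) K
  simp only [extendZero_coe, one_pow, one_mul] at hfreq
  have hfr : IsCompact (frontier (K : Set V)) :=
    K.isCompact.of_isClosed_subset isClosed_frontier K.isClosed.frontier_subset
  have hle : ∀ ε : ℝ, 0 < ε →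
      ‖ψ K‖ₑ * μ (halfOpenCube b) ≤ ENNReal.ofReal ε * μ (K : Set V) := by
    intro ε hε
    obtain ⟨δ, hδ, hδ'⟩ := hcube _ (isCompact_cornerRegion b K) ε hε
    have hsmall : ∀ᶠ h in 𝓝[>] (0 : ℝ), h ∈ Ioc (0 : ℝ) 1 := Ioc_mem_nhdsGT one_pos
    have hsmall' : ∀ᶠ h in 𝓝[>] (0 : ℝ), h ∈ Ioo (0 : ℝ) δ := Ioo_mem_nhdsGT hδ
    have hlim := (ENNReal.Tendsto.const_mul
      (tendsto_measure_cthickening_mul μ hfr (Metric.diam (unitCube b : Set V)))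
      (a := ENNReal.ofReal C) (Or.inr (by finiteness))).const_add
        (ENNReal.ofReal ε * μ (K : Set V))
    rw [K.convex.addHaar_frontier μ, mul_zero, add_zero] at hlim
    refine ge_of_tendsto_of_frequently hlim
      ((hfreq.and_eventually (hsmall.and hsmall')).mono ?_)
    rintro h ⟨⟨a, m, hsum⟩, ⟨hh, hh1⟩, hh'⟩
    classical
    let F₁ : Finset (Fin n → Fin m) := Finset.univ.filter fun k => cell b a h k ⊆ K
    let F₂ : Finset (Fin n → Fin m) :=
      Finset.univ.filter fun k => (cell b a h k ∩ frontier (K : Set V)).Nonempty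
    -- Cells inside K are full cubes and get the ε bound; the others either miss K or meet its
    -- frontier and get the C bound. A cell in K touching the frontier is counted in both terms,
    -- harmlessly for an upper bound.
    have hterm : ∀ k : Fin n → Fin m, ‖extendZero ψ (K ∩ cell b a h k)‖ₑ ≤
        (if cell b a h k ⊆ K then ENNReal.ofReal ε * ENNReal.ofReal (h ^ n) else 0) +
        if (cell b a h k ∩ frontier (K : Set V)).Nonempty then
          ENNReal.ofReal C * ENNReal.ofReal (h ^ n) else 0 := by
      intro k
      by_cases hk : cell b a h k ⊆ K
      · rw [if_pos hk]
        refine le_trans ?_ le_self_add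
        have hne : ((K : Set V) ∩ cell b a h k).Nonempty :=
          ⟨_, hk (corner_mem_cell b hh k), corner_mem_cell b hh k⟩
        have h1 := hδ' h hh' _ (corner_mem_cornerRegion b hh hh1 hne)
        rw [inter_eq_right.2 hk, cell_eq_coe b hh, extendZero_coe,
          ← ENNReal.ofReal_mul' (by positivity), ← ofReal_norm]
        exact ENNReal.ofReal_le_ofReal h1
      · rw [if_neg hk, zero_add]
        by_cases hne : ((K : Set V) ∩ cell b a h k).Nonempty
        -- A connected cell that meets K without lying in K must meet the frontier.
        · have hconn : IsPreconnected (cell b a h k) := by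
            rw [cell_eq_coe b hh]
            exact (ConvexBody.convex _).isPreconnected
          have hfrne : (cell b a h k ∩ frontier (K : Set V)).Nonempty := by
            obtain ⟨y, hy, hyK⟩ := not_subset.1 hk
            rw [inter_comm] at hne
            by_contra hno
            have hcov : cell b a h k ⊆ interior (K : Set V) ∪ (K : Set V)ᶜ := fun z hz => by
              by_contra hz'
              simp only [mem_union, mem_compl_iff, not_or, not_not] at hz'
              exact hno ⟨z, hz, subset_closure hz'.2, hz'.1⟩
            have hne' : (cell b a h k ∩ interior (K : Set V)).Nonempty := by
              obtain ⟨z, hz, hzK⟩ := hne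
              exact ⟨z, hz, (hcov hz).resolve_right fun h => h hzK⟩
            obtain ⟨z, -, hz1, hz2⟩ := hconn _ _ isOpen_interior K.isClosed.isOpen_compl hcov hne'
              ⟨y, hy, hyK⟩
            exact hz2 (interior_subset hz1)
          rw [if_pos hfrne]
          unfold extendZero
          split_ifs with hT
          · exact enorm_le_of_subset_cell b hC hh hh1 (T := bodyOf _ hT.1 hT.2.1 hT.2.2)
              (subset_refl _)
          · simp
        · rw [not_nonempty_iff_eq_empty.1 hne, extendZero_empty]
          simp
    have hcard₁ := card_mul_le_measure b μ rfl hh F₁ (T := (K : Set V)) fun k hk =>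
      (Finset.mem_filter.1 hk).2
    have hcard₂ := card_mul_le_measure b μ rfl hh F₂
      (T := Metric.cthickening (h * Metric.diam (unitCube b : Set V)) (frontier (K : Set V)))
      fun k hk => cell_subset_cthickening b hh (Finset.mem_filter.1 hk).2
    have hsum' := hsum.trans (Finset.sum_le_sum fun k _ => hterm k)
    rw [Finset.sum_add_distrib, ← Finset.sum_filter, ← Finset.sum_filter, Finset.sum_const,
      Finset.sum_const, nsmul_eq_mul, nsmul_eq_mul] at hsum'
    calc ‖ψ K‖ₑ * μ (halfOpenCube b)
        ≤ (F₁.card * (ENNReal.ofReal ε * ENNReal.ofReal (h ^ n)) +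
            F₂.card * (ENNReal.ofReal C * ENNReal.ofReal (h ^ n))) * μ (halfOpenCube b) := by
          gcongr
      _ = ENNReal.ofReal ε * (F₁.card * ENNReal.ofReal (h ^ n) * μ (halfOpenCube b)) +
          ENNReal.ofReal C * (F₂.card * ENNReal.ofReal (h ^ n) * μ (halfOpenCube b)) := by ring
      _ ≤ _ := by gcongr
  have hlim : Tendsto (fun ε : ℝ => ENNReal.ofReal ε * μ (K : Set V)) (𝓝[>] 0)
      (𝓝 (ENNReal.ofReal 0 * μ (K : Set V))) :=
    ENNReal.Tendsto.mul_const ((ENNReal.continuous_ofReal.tendsto 0).mono_left nhdsWithin_le_nhds)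
      (Or.inr K.isCompact.measure_lt_top.ne)
  rw [ENNReal.ofReal_zero, zero_mul] at hlim
  have h0 : ‖ψ K‖ₑ * μ (halfOpenCube b) ≤ 0 :=
    ge_of_tendsto hlim (eventually_mem_nhdsWithin.mono hle)
  have h1 := (mul_eq_zero.1 (nonpos_iff_eq_zero.1 h0)).resolve_right
    (measure_halfOpenCube_ne_zero b μ)
  simpa using h1

end Vanishing

/-! ### Smoothness from directional derivatives -/

section Directional

variable {V E : Type*} [NormedAddCommGroup V] [NormedSpace ℝ V]
  [NormedAddCommGroup E] [NormedSpace ℝ E]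

/-- A function with continuous partial derivatives along a basis is differentiable. -/
lemma hasFDerivAt_of_hasLineDerivAt_basis {ι : Type*} [Fintype ι] (b : Module.Basis ι ℝ V)
    [FiniteDimensional ℝ V] {h : V → E} {g : ι → V → E} (hg : ∀ i, Continuous (g i))
    (hd : ∀ i x, HasLineDerivAt ℝ h (g i x) x (b i)) (x₀ : V) :
    HasFDerivAt h (∑ i, (b.coord i).toContinuousLinearMap.smulRight (g i x₀)) x₀ := by
  classical
  let e : V ≃L[ℝ] (ι → ℝ) := b.equivFunL
  let F : (ι → ℝ) → E := fun c => h (x₀ + e.symm c)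
  have hesymm : ∀ i, e.symm (Pi.single i 1) = b i := fun i => by
    rw [e.symm_apply_eq]
    ext j
    change _ = b.equivFun (b i) j
    rw [b.equivFun_self]
    simp [Pi.single_apply, eq_comm]
  have hpart : ∀ (a : ι) (c : ι → ℝ) (t : ℝ), HasDerivAt (fun s => F (Function.update c a s))
      (g a (x₀ + e.symm (Function.update c a t))) t := by
    intro a c t
    have h1 := hd a (x₀ + e.symm (Function.update c a t))
    have h2 : HasDerivAt (fun s : ℝ => h (x₀ + e.symm (Function.update c a t) + s • b a))
      (g a (x₀ + e.symm (Function.update c a t))) (t - t) := by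
      rw [sub_self]; exact h1
    refine (h2.comp_sub_const t t).congr_of_eventuallyEq (.of_forall fun s => ?_)
    have : Function.update c a s = Function.update c a t + (s - t) • Pi.single a 1 := by
      ext j
      rcases eq_or_ne j a with rfl | hj <;> simp [*]
    simp only [F]
    rw [this, map_add, map_smul, hesymm, add_assoc]
  have hupd : ∀ (c : ι → ℝ) (a : ι) (t : ℝ), |t| ≤ |c a| → ‖Function.update c a t‖ ≤ ‖c‖ := by
    intro c a t ht
    refine (pi_norm_le_iff_of_nonneg (norm_nonneg _)).2 fun j => ?_
    rcases eq_or_ne j a with rfl | hj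
    · rw [Function.update_self]
      exact ht.trans (norm_le_pi_norm c j)
    · rw [Function.update_of_ne hj]
      exact norm_le_pi_norm c j
  -- Induction on the set of coordinates allowed to be nonzero: each step moves along a single axis,
  -- where the mean value inequality applies. Radius δ is chosen before the induction and serves all
  -- steps.
  have key : ∀ ε > 0, ∃ δ > 0, ∀ s : Finset ι, ∀ c : ι → ℝ, (∀ i ∉ s, c i = 0) → ‖c‖ < δ →
      ‖F c - F 0 - ∑ i ∈ s, c i • g i x₀‖ ≤ ε * s.card * ‖c‖ := by
    intro ε hε
    have hev : ∀ᶠ c in 𝓝 (0 : ι → ℝ), ∀ i, ‖g i (x₀ + e.symm c) - g i x₀‖ < ε := by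
      rw [Filter.eventually_all]
      intro i
      have hc : Continuous fun c => ‖g i (x₀ + e.symm c) - g i x₀‖ :=
        (((hg i).comp (continuous_const.add e.symm.continuous)).sub continuous_const).norm
      refine hc.continuousAt.eventually_lt continuousAt_const ?_
      simpa using hε
    obtain ⟨δ, hδ, hball⟩ := Metric.eventually_nhds_iff_ball.1 hev
    refine ⟨δ, hδ, fun s => ?_⟩
    induction s using Finset.induction_on with
    | empty =>
      intro c hc _
      have : c = 0 := funext fun i => hc i (Finset.notMem_empty i)
      simp [this]
    | insert a s ha ih =>
      intro c hc hcδ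
      have hc0 : ‖Function.update c a 0‖ ≤ ‖c‖ := hupd c a 0 (by simp)
      have h1 := ih (Function.update c a 0) (fun i hi => by
        rcases eq_or_ne i a with rfl | hia
        · simp
        · rw [Function.update_of_ne hia]
          exact hc i (by simp [hia, hi])) (hc0.trans_lt hcδ)
      have hsum : ∑ i ∈ s, Function.update c a 0 i • g i x₀ = ∑ i ∈ s, c i • g i x₀ :=
        Finset.sum_congr rfl fun i hi => by
          have hia : i ≠ a := fun h => ha (h ▸ hi)
          rw [Function.update_of_ne hia]
      have h2 := (convex_uIcc (0 : ℝ) (c a)).norm_image_sub_le_of_norm_hasDerivWithin_le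
        (f := fun t => F (Function.update c a t) - t • g a x₀)
        (f' := fun t => g a (x₀ + e.symm (Function.update c a t)) - g a x₀) (C := ε)
        (fun t _ => ((hpart a c t).sub
          (by simpa using (hasDerivAt_id t).smul_const (g a x₀))).hasDerivWithinAt)
        (fun t ht => by
          have habs : |t| ≤ |c a| := by
            have := abs_sub_left_of_mem_uIcc ht
            simpa using this
          exact (hball _ (by
            rw [mem_ball_zero_iff]
            exact (hupd c a t habs).trans_lt hcδ) a).le)
        left_mem_uIcc right_mem_uIcc
      simp only [Function.update_eq_self, zero_smul, sub_zero] at h2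
      have h3 : ‖c a‖ ≤ ‖c‖ := norm_le_pi_norm c a
      rw [hsum] at h1
      rw [Finset.sum_insert ha, Finset.card_insert_of_notMem ha]
      have h4 : F c - F 0 - (c a • g a x₀ + ∑ i ∈ s, c i • g i x₀) =
          (F c - c a • g a x₀ - F (Function.update c a 0)) +
            (F (Function.update c a 0) - F 0 - ∑ i ∈ s, c i • g i x₀) := by abel
      rw [h4]
      refine (norm_add_le _ _).trans ?_
      have h5 : ε * ‖c a‖ ≤ ε * ‖c‖ := by gcongr
      have h6 : ε * s.card * ‖Function.update c a 0‖ ≤ ε * s.card * ‖c‖ := by gcongr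
      push_cast
      nlinarith
  let L : (ι → ℝ) →L[ℝ] E :=
    ∑ i, (ContinuousLinearMap.proj (R := ℝ) (φ := fun _ : ι => ℝ) i).smulRight (g i x₀)
  have hF : HasFDerivAt F L 0 := by
    rw [hasFDerivAt_iff_isLittleO_nhds_zero, Asymptotics.isLittleO_iff]
    intro ε hε
    -- The division compensates for the number of axes; adding 1 keeps the divisor positive if there
    -- are none.
    obtain ⟨δ, hδ, hk⟩ := key (ε / (Fintype.card ι + 1)) (by positivity)
    filter_upwards [Metric.ball_mem_nhds (0 : ι → ℝ) hδ] with c hc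
    have h1 := hk Finset.univ c (fun i hi => absurd (Finset.mem_univ i) hi)
      (mem_ball_zero_iff.1 hc)
    rw [zero_add]
    have h2 : L c = ∑ i, c i • g i x₀ := by simp [L]
    rw [h2]
    refine h1.trans ?_
    gcongr
    rw [Finset.card_univ, div_mul_eq_mul_div, div_le_iff₀ (by positivity)]
    nlinarith
  have hcomp : h = F ∘ fun x => e (x - x₀) := by
    ext x
    simp [F]
  have he : HasFDerivAt (fun x => e (x - x₀)) (e : V →L[ℝ] (ι → ℝ)) x₀ :=
    e.hasFDerivAt.comp x₀ ((hasFDerivAt_id x₀).sub_const x₀)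
  have hF' : HasFDerivAt F L (e (x₀ - x₀)) := by
    rwa [sub_self, map_zero]
  have := hF'.comp x₀ he
  rw [← hcomp] at this
  refine this.congr_fderiv ?_
  ext v
  simp [e, L]

/-- Continuous derivatives along a basis assemble into a Fréchet derivative with C^k coefficients,
and induction proceeds. This converts the directional notion of smoothness used for `QV V` into
`ContDiff`. -/
lemma contDiff_of_isCkOn [FiniteDimensional ℝ V] (k : ℕ) {h : V → E}
    (hh : IsCkOn univ k h) : ContDiff ℝ k h := by
  induction k generalizing h with
  | zero => exact contDiff_zero.2 (continuousOn_univ.1 hh)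
  | succ k ih =>
    let b := Module.finBasis ℝ V
    have h2 := fun i => hh.2 (b i)
    choose g hg hgk using h2
    have hgc : ∀ i, ContDiff ℝ k (g i) := fun i => ih (hgk i)
    have hd : ∀ i x, HasLineDerivAt ℝ h (g i x) x (b i) := by
      intro i x
      refine hasDerivAt_iff_tendsto_slope_zero.2 ?_
      simpa using hg i x (mem_univ x)
    refine contDiff_succ_iff_hasFDerivAt.2 ⟨_, ?_,
      hasFDerivAt_of_hasLineDerivAt_basis b (fun i => (hgc i).continuous) hd⟩
    exact ContDiff.sum fun i _ =>
      ((ContinuousLinearMap.smulRightL ℝ V E) (b.coord i).toContinuousLinearMap).contDiff.comp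
        (hgc i)

/-- Difference quotients commute with a continuous linear `l` and with restriction to an affine
subfamily. It is applied to an orbit map restricted to translations and composed with `vertexDeriv`.
-/
lemma IsCkOn.comp_affine {X F : Type*} [NormedAddCommGroup X] [NormedSpace ℝ X]
    [AddCommGroup F] [Module ℝ F] [TopologicalSpace F] {U : Set X} {k : ℕ} {f : X → F}
    (hf : IsCkOn U k f) {l : F →ₗ[ℝ] E} (hl : Continuous l) (A : V →L[ℝ] X) (p : X)
    (hU : ∀ x, p + A x ∈ U) : IsCkOn univ k fun x => l (f (p + A x)) := by
  have hA : Continuous fun x => p + A x := by fun_prop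
  have hcont : ∀ {f : X → F}, ContinuousOn f U → ContinuousOn (fun x => l (f (p + A x))) univ :=
    fun hf => hl.comp_continuousOn (hf.comp hA.continuousOn fun x _ => hU x)
  induction k generalizing f with
  | zero => exact hcont hf
  | succ k ih =>
    refine ⟨hcont hf.1, fun v => ?_⟩
    obtain ⟨f', hf', hk⟩ := hf.2 (A v)
    refine ⟨fun x => l (f' (p + A x)), fun x _ => ?_, ih hk⟩
    refine ((hl.tendsto _).comp (hf' _ (hU x))).congr fun t => ?_
    simp only [Function.comp, map_smul, map_sub, map_add, add_assoc]

end Directional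

/-! ### Taylor estimates -/

section Taylor

variable {V : Type*} [NormedAddCommGroup V] [NormedSpace ℝ V]

/-- The Taylor polynomial at 0 vanishes, so only the remainder is left, and the factorial in its
bound is dropped. -/
lemma norm_le_mul_pow_of_iteratedDerivWithin {n : ℕ} {u : ℝ → ℂ}
    (hu : ContDiffOn ℝ n u (Icc 0 1))
    (h0 : ∀ k < n, iteratedDerivWithin k u (Icc 0 1) 0 = 0) {τ C : ℝ} (hτ : τ ∈ Icc (0 : ℝ) 1)
    (hC : ∀ t ∈ Icc 0 τ, ‖iteratedDerivWithin n u (Icc 0 1) t‖ ≤ C) : ‖u τ‖ ≤ C * τ ^ n := by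
  rcases n with _ | m
  · simpa using hC τ ⟨hτ.1, le_rfl⟩
  rcases hτ.1.eq_or_lt with rfl | hpos
  · have := h0 0 (by omega)
    rw [iteratedDerivWithin_zero] at this
    simp [this]
  have hC0 : 0 ≤ C := (norm_nonneg _).trans (hC 0 ⟨le_rfl, hτ.1⟩)
  -- Taylor's formula is applied on [0, τ], where the bound is assumed; for τ > 0 the derivatives
  -- within [0, τ] and within [0, 1] agree there.
  have hsub : Icc 0 τ ⊆ Icc (0 : ℝ) 1 := Icc_subset_Icc_right hτ.2
  have hder : ∀ k ≤ m + 1, ∀ t ∈ Icc 0 τ,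
      iteratedDerivWithin k u (Icc 0 τ) t = iteratedDerivWithin k u (Icc 0 1) t := by
    intro k hk t ht
    unfold iteratedDerivWithin
    rw [iteratedFDerivWithin_subset hsub (uniqueDiffOn_Icc hpos) uniqueDiffOn_Icc_zero_one
      (hu.of_le (by exact_mod_cast hk)) ht]
  have h := taylor_mean_remainder_bound (n := m) hτ.1 ((hu.mono hsub).of_le (by simp))
    (right_mem_Icc.2 hτ.1) fun t ht => by
      rw [hder _ le_rfl t ht]; exact hC t ht
  have htaylor : taylorWithinEval u m (Icc 0 τ) 0 τ = 0 := by
    rw [taylor_within_apply]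
    refine Finset.sum_eq_zero fun k hk => ?_
    have hk : k < m + 1 := Finset.mem_range.1 hk
    rw [hder k hk.le 0 (left_mem_Icc.2 hτ.1), h0 k hk, smul_zero]
  rw [htaylor, sub_zero, sub_zero] at h
  refine h.trans (div_le_self (by positivity) ?_)
  exact_mod_cast Nat.one_le_iff_ne_zero.2 (Nat.factorial_ne_zero m)

open scoped Pointwise in
-- The curve is `scaleTranslate φ K` along the first axis. This carries seminorm bounds over to
-- one-variable Taylor estimates.
lemma iteratedDerivWithin_homothets {φ : ConvexBody V → ℂ} (hφ : IsQuasiSmooth φ)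
    (K : ConvexBody V) (x : V) {k : ℕ} (hk : k ≤ Module.finrank ℝ V) {t : ℝ}
    (ht : t ∈ Icc (0 : ℝ) 1) :
    iteratedDerivWithin k (homothets φ K x) (Icc 0 1) t = stDeriv k φ K (t, x) fun _ => (1, 0) := by
  let A : ℝ →L[ℝ] ℝ × V := ContinuousLinearMap.inl ℝ ℝ V
  have hpre : A ⁻¹' strip V = Icc (0 : ℝ) 1 := by
    ext s; simp [A, strip]
  have hs' : ((0 : ℝ), x) +ᵥ strip V = strip V := by
    ext q; simp [strip, mem_vadd_set_iff_neg_vadd_mem]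
  have hcd : ContDiffOn ℝ k (fun w => scaleTranslate φ K (w + (0, x))) (strip V) := by
    refine ((hφ.contDiffOn K).of_le (by exact_mod_cast hk)).comp
      (contDiff_id.add contDiff_const).contDiffOn fun w hw => ?_
    simpa [strip] using hw
  have hcomp : homothets φ K x = (fun w => scaleTranslate φ K (w + (0, x))) ∘ A := by
    ext s; simp [homothets, scaleTranslate, A]
  have hAt : A t ∈ strip V := by rwa [← mem_preimage, hpre]
  rw [iteratedDerivWithin, hcomp]
  conv_lhs => rw [← hpre]
  rw [A.iteratedFDerivWithin_comp_right hcd uniqueDiffOn_strip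
    (by rw [hpre]; exact uniqueDiffOn_Icc_zero_one) hAt le_rfl,
    iteratedFDerivWithin_comp_add_right, hs']
  simp [stDeriv, A]

lemma contDiffOn_homothets {φ : ConvexBody V → ℂ} (hφ : IsQuasiSmooth φ) (K : ConvexBody V)
    (x : V) : ContDiffOn ℝ (Module.finrank ℝ V) (homothets φ K x) (Icc 0 1) := by
  refine (hφ.contDiffOn K).comp (f := fun t : ℝ => (t, x)) ?_ fun t ht => ⟨ht, mem_univ _⟩
  fun_prop

lemma norm_stDeriv_apply_le (φ : ConvexBody V → ℂ) (k : ℕ) (K : ConvexBody V) (p : ℝ × V) :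
    ‖stDeriv k φ K p fun _ => (1, 0)‖ ≤ ‖stDeriv k φ K p‖ := by
  have := (stDeriv k φ K p).le_opNorm fun _ => (1, 0)
  simpa using this

/-- Quasi-smooth valuations in the `n`-th filtration step are `O(t ^ n)` on small bodies. -/
lemma exists_norm_homothet_le {ψ : ConvexBody V → ℂ} (hψ : IsQuasiSmooth ψ)
    (h0 : ∀ k < Module.finrank ℝ V, ∀ K x, iteratedDerivWithin k (homothets ψ K x) (Icc 0 1) 0 = 0)
    {G : Set V} (hG : IsCompact G) :
    ∃ C : ℝ, ∀ L : ConvexBody V, (L : Set V) ⊆ G → ∀ x ∈ G, ∀ t ∈ Icc (0 : ℝ) 1,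
      ‖ψ (t • L + point x)‖ ≤ C * t ^ Module.finrank ℝ V := by
  -- The uniform constant is a bound on the terms of the seminorm of ψ over G, finite because the
  -- bodies in G form a compact family.
  obtain ⟨C, hC⟩ := bddAbove_seminormTerm hG (QV.ofIsQuasiSmooth ψ hψ)
  refine ⟨C, fun L hL x hx t ht => ?_⟩
  refine norm_le_mul_pow_of_iteratedDerivWithin (contDiffOn_homothets hψ L x)
    (fun k hk => h0 k hk L x) ht fun s hs => ?_
  have hs1 : s ∈ Icc (0 : ℝ) 1 := ⟨hs.1, hs.2.trans ht.2⟩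
  rw [iteratedDerivWithin_homothets hψ L x le_rfl hs1]
  exact (norm_stDeriv_apply_le ψ _ L (s, x)).trans
    (hC ⟨⟨(L, Module.finrank ℝ V, (s, x)), hL, le_rfl, hs1, hx⟩, rfl⟩)

/-- If moreover the `n`-th derivatives at `0` vanish for some body, then the values at small
homothets of this body are `o(t ^ n)`. -/
lemma exists_norm_homothet_le_mul {ψ : ConvexBody V → ℂ} (hψ : IsQuasiSmooth ψ)
    (Q : ConvexBody V)
    (h0 : ∀ k ≤ Module.finrank ℝ V, ∀ x, iteratedDerivWithin k (homothets ψ Q x) (Icc 0 1) 0 = 0)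
    {G : Set V} (hG : IsCompact G) {ε : ℝ} (hε : 0 < ε) :
    ∃ δ > 0, ∀ t ∈ Ioo (0 : ℝ) δ, ∀ x ∈ G,
      ‖ψ (t • Q + point x)‖ ≤ ε * t ^ Module.finrank ℝ V := by
  -- Projecting t to [0,1] extends the n-th derivative continuously to all real t, so that smallness
  -- near t = 0 can be made uniform over the compact set G.
  let w : ℝ × V → ℂ := fun p =>
    stDeriv (Module.finrank ℝ V) ψ Q ((projIcc (0 : ℝ) 1 zero_le_one p.1 : ℝ), p.2) fun _ => (1, 0)
  have hw : Continuous w := by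
    have h1 : ContinuousOn (stDeriv (Module.finrank ℝ V) ψ Q) (strip V) :=
      (hψ.contDiffOn Q).continuousOn_iteratedFDerivWithin le_rfl uniqueDiffOn_strip
    have h2 : Continuous fun p : ℝ × V => ((projIcc (0 : ℝ) 1 zero_le_one p.1 : ℝ), p.2) :=
      (continuous_subtype_val.comp (continuous_projIcc.comp continuous_fst)).prodMk continuous_snd
    have h3 := h1.comp_continuous h2 fun p => ⟨(projIcc (0 : ℝ) 1 zero_le_one p.1).2, mem_univ _⟩
    exact (ContinuousMultilinearMap.apply ℝ (fun _ => ℝ × V) ℂ fun _ => (1, 0)).continuous.comp h3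
  have hw1 : ∀ t ∈ Icc (0 : ℝ) 1, ∀ x, w (t, x) =
      iteratedDerivWithin (Module.finrank ℝ V) (homothets ψ Q x) (Icc 0 1) t := by
    intro t ht x
    rw [iteratedDerivWithin_homothets hψ Q x le_rfl ht]
    simp only [w]
    rw [projIcc_of_mem zero_le_one ht]
  have hev : ∀ᶠ t in 𝓝 (0 : ℝ), ∀ x ∈ G, ‖w (t, x)‖ < ε := by
    refine hG.eventually_forall_of_forall_eventually fun x _ => ?_
    refine hw.norm.continuousAt.eventually_lt continuousAt_const ?_
    rw [hw1 0 (by simp), h0 _ le_rfl]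
    simpa using hε
  obtain ⟨δ, hδ, hball⟩ := Metric.eventually_nhds_iff_ball.1 hev
  refine ⟨min δ 1, by positivity, fun t ht x hx => ?_⟩
  have ht1 : t ∈ Icc (0 : ℝ) 1 := ⟨ht.1.le, (ht.2.trans_le (min_le_right _ _)).le⟩
  refine norm_le_mul_pow_of_iteratedDerivWithin (contDiffOn_homothets hψ Q x)
    (fun k hk => h0 k hk.le x) ht1 fun s hs => ?_
  rw [← hw1 s ⟨hs.1, hs.2.trans ht1.2⟩]
  refine (hball s ?_ x hx).le
  rw [mem_ball_zero_iff, Real.norm_of_nonneg hs.1]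
  exact hs.2.trans_lt (ht.2.trans_le (min_le_left _ _))

end Taylor

/-! ### The density of a valuation in the `n`-th filtration step -/

section Surjectivity

variable {V : Type*} [NormedAddCommGroup V] [NormedSpace ℝ V] [FiniteDimensional ℝ V]

/-- The `n`-th derivative of `t ↦ φ(tQ)` at `t = 0`, as a linear functional of `φ`. -/
def vertexDeriv (Q : ConvexBody V) : QV V →ₗ[ℂ] ℂ where
  toFun φ := stDeriv (Module.finrank ℝ V) (QV.incl V φ) Q (0, 0) fun _ => (1, 0)
  map_add' φ ψ := by
    rw [map_add, stDeriv_add φ.isQuasiSmooth ψ.isQuasiSmooth le_rfl Q ⟨by simp, mem_univ _⟩]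
    rfl
  map_smul' c φ := by
    rw [map_smul, stDeriv_smul φ.isQuasiSmooth c le_rfl Q ⟨by simp, mem_univ _⟩]
    rfl

lemma continuous_vertexDeriv (Q : ConvexBody V) : Continuous (vertexDeriv Q) := by
  -- The seminorm must see both the body Q and the base point x = 0.
  let G : TopologicalSpace.Compacts V := ⟨insert 0 (Q : Set V), Q.isCompact.insert 0⟩
  refine withSeminorms_QV.continuous_normedSpace_rng ℂ _ ⟨{G}, 1, fun φ => ?_⟩
  rw [Finset.sup_singleton, one_smul]
  refine (norm_stDeriv_apply_le _ _ _ _).trans ?_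
  exact le_ciSup (bddAbove_seminormTerm G.isCompact φ) (⟨(Q, Module.finrank ℝ V, (0, 0)),
    subset_insert 0 _, le_rfl, by simp, mem_insert 0 _⟩ : SeminormIndex (G : Set V))

open scoped Pointwise in
-- Acting by the translation by -x replaces φ by K ↦ φ(K + x). Derivatives at varying x become one
-- fixed functional evaluated along an orbit.
lemma vertexDeriv_affAct_translation (Q : ConvexBody V) (φ : QV V) (x : V) :
    vertexDeriv Q (affAct (AffineEquiv.constVAdd ℝ V (-x)) φ) =
      iteratedDerivWithin (Module.finrank ℝ V) (homothets (QV.incl V φ) Q x) (Icc 0 1) 0 := by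
  have h0 : (0 : ℝ) ∈ Icc (0 : ℝ) 1 := by simp
  have h1 : homothets (QV.incl V (affAct (AffineEquiv.constVAdd ℝ V (-x)) φ)) Q 0 =
      homothets (QV.incl V φ) Q x := by
    funext t
    change QV.incl V φ (affImage _ _) = QV.incl V φ _
    refine congrArg (QV.incl V φ) ?_
    apply ConvexBody.ext
    have hg : ⇑((AffineEquiv.constVAdd ℝ V (-x))⁻¹ : V ≃ᵃ[ℝ] V) = fun y => y + x := by
      funext y
      change - -x + y = y + x
      rw [neg_neg, add_comm]
    change ⇑((AffineEquiv.constVAdd ℝ V (-x))⁻¹ : V ≃ᵃ[ℝ] V) ''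
      (((t • Q : ConvexBody V) : Set V) + ({0} : Set V)) =
        ((t • Q : ConvexBody V) : Set V) + ({x} : Set V)
    rw [hg, add_singleton, add_singleton]
    simp
  rw [← h1, iteratedDerivWithin_homothets (QV.isQuasiSmooth _) Q 0 le_rfl h0]
  rfl

/-- For a smooth valuation `φ`, the `n`-th derivative of `t ↦ φ(tQ + x)` at `t = 0` is a smooth
function of `x`. -/
lemma contDiff_iteratedDerivWithin_homothets (Q : ConvexBody V) {φ : QV V} (hφ : φ ∈ SV V) :
    ContDiff ℝ ∞ fun x => iteratedDerivWithin (Module.finrank ℝ V)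
      (homothets (QV.incl V φ) Q x) (Icc 0 1) 0 := by
  obtain ⟨f, hf, hfg⟩ := hφ
  rw [contDiff_infty]
  intro k
  -- With `A x` = (0, -x), the point (id, 0) + A x is the coordinate of the translation by -x.
  let A : V →L[ℝ] (V →L[ℝ] V) × V := ContinuousLinearMap.inr ℝ _ _ ∘L (-ContinuousLinearMap.id ℝ V)
  have h1 := contDiff_of_isCkOn k ((hf k).comp_affine (l := (vertexDeriv Q).restrictScalars ℝ)
    (continuous_vertexDeriv Q) A (ContinuousLinearMap.id ℝ V, 0) fun x => by
      change IsUnit (ContinuousLinearMap.id ℝ V + 0)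
      rw [add_zero]
      exact isUnit_one)
  convert h1 using 2 with x
  have h2 : affCoord (AffineEquiv.constVAdd ℝ V (-x)) =
      ((ContinuousLinearMap.id ℝ V, 0) + A x : (V →L[ℝ] V) × V) := by
    refine Prod.ext ?_ ?_
    · ext v
      simp [affCoord, A]
    · simp [affCoord, A]
  rw [← vertexDeriv_affAct_translation, ← hfg, h2]
  rfl

variable [MeasurableSpace V] [BorelSpace V] (μ : Measure V) [μ.IsAddHaarMeasure]

/-- The density is read off from the unit cube Q alone, normalised by n! μ(Q) so that the n-th
derivatives of the difference vanish on Q. One shape is enough, because all grid cells are homothets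
of Q. -/
lemma exists_evalDensity_eq {φ : ConvexBody V → ℂ} (hφ : φ ∈ W V (Module.finrank ℝ V)) :
    ∃ f : V → ℂ, ContDiff ℝ ∞ f ∧ evalDensity μ f = φ := by
  obtain ⟨⟨φ, hφS, rfl⟩, hφ0⟩ := hφ
  let b := Module.finBasis ℝ V
  let Q := unitCube b
  let n := Module.finrank ℝ V
  have hQ : μ.real (Q : Set V) ≠ 0 := by
    have hsub : halfOpenCube b ⊆ (Q : Set V) := fun x hx i => Ico_subset_Icc_self (hx i)
    have hpos : 0 < μ (Q : Set V) :=
      (pos_iff_ne_zero.2 (measure_halfOpenCube_ne_zero b μ)).trans_le (measure_mono hsub)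
    exact (ENNReal.toReal_pos hpos.ne' Q.isCompact.measure_lt_top.ne).ne'
  have hc : (n.factorial * μ.real (Q : Set V)) ≠ 0 :=
    mul_ne_zero (by exact_mod_cast Nat.factorial_ne_zero n) hQ
  let D : V → ℂ := fun x => iteratedDerivWithin n (homothets (QV.incl V φ) Q x) (Icc 0 1) 0
  have hD : ContDiff ℝ ∞ D := contDiff_iteratedDerivWithin_homothets Q hφS
  let f : V → ℂ := fun x => (n.factorial * μ.real (Q : Set V))⁻¹ • D x
  have hf : ContDiff ℝ ∞ f := hD.const_smul _
  refine ⟨f, hf, ?_⟩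
  have h0 : (0 : ℝ) ∈ Icc (0 : ℝ) 1 := by simp
  have hq := φ.isQuasiSmooth
  have hqf := isQuasiSmooth_evalDensity μ hf
  have hψ : IsQuasiSmooth (QV.incl V φ - evalDensity μ f) :=
    (quasiSmoothSubmodule V).sub_mem hq hqf
  have hsub : ∀ k ≤ n, ∀ K x,
      iteratedDerivWithin k (homothets (QV.incl V φ - evalDensity μ f) K x) (Icc 0 1) 0 =
        iteratedDerivWithin k (homothets (QV.incl V φ) K x) (Icc 0 1) 0 -
          iteratedDerivWithin k (homothets (evalDensity μ f) K x) (Icc 0 1) 0 := by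
    intro k hk K x
    have hk : (k : WithTop ℕ∞) ≤ n := by exact_mod_cast hk
    exact iteratedDerivWithin_sub h0 uniqueDiffOn_Icc_zero_one
      ((contDiffOn_homothets hq K x 0 h0).of_le hk) ((contDiffOn_homothets hqf K x 0 h0).of_le hk)
  have hlt : ∀ k < n, ∀ K x,
      iteratedDerivWithin k (homothets (QV.incl V φ - evalDensity μ f) K x) (Icc 0 1) 0 = 0 := by
    intro k hk K x
    rw [hsub k hk.le, iteratedDerivWithin_homothets_evalDensity μ hf K x hk.le, if_neg hk.ne,
      sub_zero]
    exact hφ0 k hk K x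
  have hle : ∀ k ≤ n, ∀ x,
      iteratedDerivWithin k (homothets (QV.incl V φ - evalDensity μ f) Q x) (Icc 0 1) 0 = 0 := by
    intro k hk x
    rcases hk.lt_or_eq with hk | rfl
    · exact hlt k hk Q x
    · rw [hsub n le_rfl, iteratedDerivWithin_homothets_evalDensity μ hf Q x le_rfl, if_pos rfl]
      simp only [f]
      rw [smul_inv_smul₀ hc, sub_self]
  funext K
  have := eq_zero_of_small_growth b rfl hψ.isValuation
    (fun G hG => exists_norm_homothet_le hψ hlt hG)
    (fun G hG ε hε => exists_norm_homothet_le_mul hψ Q hle hG hε) K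
  exact (sub_eq_zero.1 this).symm

end Surjectivity

end SmoothValuation

end

theorem proposition3p2 {V : Type*} [NormedAddCommGroup V] [NormedSpace ℝ V]
    [FiniteDimensional ℝ V] [MeasurableSpace V] [BorelSpace V]
    (μ : MeasureTheory.Measure V) [μ.IsAddHaarMeasure] :
    Set.BijOn (SmoothValuation.evalDensity μ) (SmoothValuation.smoothDensities V)
      (SmoothValuation.W V (Module.finrank ℝ V)) :=
  ⟨fun _ hf => SmoothValuation.evalDensity_mem_W μ hf, SmoothValuation.evalDensity_injOn μ,
    fun _ hφ => SmoothValuation.exists_evalDensity_eq μ hφ⟩
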